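/- Let $\mathcal H$ be a separable complex Hilbert space and let $\tilde{\mathcal M}$ be the set of finite faithful weights $\rho$ on $B(\mathcal H)$ of the following kind: $\rho$ is an injective positive bounded operator such that $\rho^p$ is of trace class for some $p\in(0,1)$. Write $\rho=e^{-H_0}$ with $H_0=-\log\rho$. For bounded self-adjoint $X$ put $\rho_X=e^{-H_0-X}$. Call $\sigma\in\tilde{\mathcal M}$ nearby $\rho$ if $C^{-1}\rho\le\sigma\le C\rho$ for some $C>1$. Let $\mathcal A_\rho$ be the space of all bounded operators $X$ such that, for each complex $t$ with $|t|<1/2$, the operator $\rho^tX\rho^{-t}$ is bounded (it is defined on the whole domain of $\rho^{-t}$ and extends to a bounded operator on $\mathcal H$, denoted in the same way), and the map $t\mapsto\rho^tX\rho^{-t}\in B(\mathcal H)$ is bounded and holomorphic in the disc $|t|<1/2$. Give $\mathcal A_\rho$ the Araki norm $\|X\|_{A,\rho}=\sup_{|t|<1/2}\|\rho^tX\rho^{-t}\|$, let $\mathcal A_\rho^{sa}$ be the real subspace of its self-adjoint elements, and let the neighbourhood of $\rho$ be $U_\rho=\{\sigma\in\tilde{\mathcal M}:\sigma=\rho_X\text{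 for some }X\in\mathcal A^{sa}_\rho\}$. Then: (1) For every $\rho\in\tilde{\mathcal M}$ the normed space $\mathcal A_\rho$ is complete. (2) $\rho\in U_\rho$, every $\sigma\in U_\rho$ is nearby $\rho$, and if $U_{\rho_0}\cap U_{\rho_1}\neq\emptyset$ then $\rho_0$ and $\rho_1$ are nearby. (3) Let $\rho_0,\rho_1\in\tilde{\mathcal M}$ be nearby. Then for $|t|<1/2$ the Connes cocycle $u_t=\rho_0^t\rho_1^{-t}$ is defined on the domain of $\rho_1^{-t}$ and extends to a bounded operator (also denoted $u_t$); $t\mapsto u_t$ is bounded and holomorphic in the disc $|t|<1/2$; and $u_t$ is invertible with inverse $\rho_1^t\rho_0^{-t}$ (understood in the same way). Moreover $\mathcal A_{\rho_0}=\mathcal A_{\rho_1}$, one has $\rho_0^tX\rho_0^{-t}=u_t\,(\rho_1^tX\rho_1^{-t})\,u_t^{-1}$ for all $X\in\mathcal A_{\rho_1}$ and $|t|<1/2$, and the norms $\|\cdot\|_{A,\rho_0}$ and $\|\cdot\|_{A,\rho_1}$ are equivalent. (4) $\tilde{\mathcal M}$ is a Banach manifold: it has a Hausdorff topology for which every $U_\rho$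 is open and, for every $\rho\in\tilde{\mathcal M}$, $X\mapsto\rho_X$ is a homeomorphism of the real Banach space $\mathcal A^{sa}_\rho$ onto $U_\rho$ whose inverse is a chart sending $\rho$ to $0$; the sets $U_\rho$ cover $\tilde{\mathcal M}$, and all changes of charts are real analytic (in particular $C^\infty$). -/

import Mathlib

namespace Araki

open scoped ContDiff

noncomputable section

section Operators

variable {H : Type*} [NormedAddCommGroup H] [InnerProductSpace ℂ H] [CompleteSpace H]

/-- A bounded operator, regarded as an (everywhere defined) partially defined operator. -/
def bdd (A : H →L[ℂ] H) : H →ₗ.[ℂ] H := (A : H →ₗ[ℂ] H).toPMap ⊤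

/-- The graph of `f(T)` for a self-adjoint operator `T` whose eigenvectors are total: the pairs
`(x, y)` such that `P y = f(μ) P x` for every real eigenvalue `μ` of `T`, with `P` the orthogonal
projection onto the eigenspace of `μ`, i.e. `⟪e, y⟫ = f(μ) ⟪e, x⟫` for all `e` with `T e = μ e`. -/
def funGraph (f : ℝ → ℂ) (T : H →ₗ.[ℂ] H) : Submodule ℂ (H × H) where
  carrier := {p | ∀ (μ : ℝ) (e : T.domain), T e = (μ : ℂ) • (e : H) →
    inner ℂ (e : H) p.2 = f μ * inner ℂ (e : H) p.1}
  add_mem' := by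
    intro p q hp hq μ e he
    simp only [Prod.snd_add, Prod.fst_add, inner_add_right, hp μ e he, hq μ e he, mul_add]
  zero_mem' := by
    intro μ e _
    simp
  smul_mem' := by
    intro c p hp μ e he
    simp only [Prod.smul_snd, Prod.smul_fst, inner_smul_right, hp μ e he]
    ring

/-- The spectral functional calculus `f(T)`, with its natural (maximal) domain, for a self-adjoint
operator `T` (possibly unbounded) whose eigenvectors are total. -/
def spectralFun (f : ℝ → ℂ) (T : H →ₗ.[ℂ] H) : H →ₗ.[ℂ] H := (funGraph f T).toLinearPMap

/-- The complex power `ρ ^ z` of a faithful positive compact operator; it is unbounded in general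
if `z.re < 0`. -/
def cpow (ρ : H →L[ℂ] H) (z : ℂ) : H →ₗ.[ℂ] H := spectralFun (fun x => (x : ℂ) ^ z) (bdd ρ)

/-- The Hamiltonian `H₀ = - log ρ`, so that `ρ = exp (-H₀)`. -/
def hamiltonian (ρ : H →L[ℂ] H) : H →ₗ.[ℂ] H :=
  spectralFun (fun x => ((-Real.log x : ℝ) : ℂ)) (bdd ρ)

/-- The perturbed weight `ρ_X = exp (-H₀ - X)`, with `H₀ = - log ρ`. -/
def perturb (ρ X : H →L[ℂ] H) : H →ₗ.[ℂ] H :=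
  spectralFun (fun x => (Real.exp (-x) : ℂ)) (hamiltonian ρ + bdd X)

/-- The product `A X B` of the (unbounded) operators `A`, `B` and the bounded operator `X` is
defined on all of the domain of `B`, and the bounded operator `Y` extends it. For `A = ρ ^ t`,
`B = ρ ^ (-t)` this is the meaning of "`ρ^t X ρ^{-t}` is the bounded operator `Y`". -/
def IsBoundedExtension (A : H →ₗ.[ℂ] H) (X : H →L[ℂ] H) (B : H →ₗ.[ℂ] H) (Y : H →L[ℂ] H) : Prop :=
  ∀ x : B.domain, ∃ h : X (B x) ∈ A.domain, A ⟨X (B x), h⟩ = Y x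

open Classical in
/-- The bounded operator given by `A X B` (and `0` if `A X B` is not bounded). -/
def boundedExtension (A : H →ₗ.[ℂ] H) (X : H →L[ℂ] H) (B : H →ₗ.[ℂ] H) : H →L[ℂ] H :=
  if h : ∃ Y, IsBoundedExtension A X B Y then h.choose else 0

/-- A positive operator `T` has finite trace: `∑ i, ⟪b i, T (b i)⟫ < ∞` for some (equivalently,
as `T` is positive, for every) orthonormal basis `b`. -/
def HasFiniteTrace (T : H →L[ℂ] H) : Prop :=
  ∃ (w : Set H) (b : HilbertBasis w ℂ H), Summable fun i => (inner ℂ (b i) (T (b i))).re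

variable (H) in
/-- The underlying set of the manifold, extended to finite weights: the faithful (injective)
positive operators `ρ` such that `ρ ^ p` is of trace class for some `p ∈ (0,1)`. -/
def Weight : Type _ :=
  {ρ : H →L[ℂ] H // ρ.IsPositive ∧ Function.Injective ρ ∧
    ∃ p : ℝ, 0 < p ∧ p < 1 ∧ HasFiniteTrace (ρ ^ p)}

/-- The density operator (weight) as an operator. -/
def Weight.op (ρ : Weight H) : H →L[ℂ] H := ρ.1

/-- `σ` is nearby `ρ`: `C⁻¹ ρ ≤ σ ≤ C ρ` for some `C > 1`. -/
def Nearby (ρ σ : Weight H) : Prop :=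
  ∃ C : ℝ, 1 < C ∧ C⁻¹ • ρ.op ≤ σ.op ∧ σ.op ≤ C • ρ.op

/-- The disc `|t| < 1/2`. -/
def disc : Set ℂ := Metric.ball 0 (1 / 2)

/-- The bounded operator `ρ^t X ρ^{-t}`. -/
def conj (ρ : Weight H) (t : ℂ) (X : H →L[ℂ] H) : H →L[ℂ] H :=
  boundedExtension (cpow ρ.op t) X (cpow ρ.op (-t))

/-- The Connes cocycle `ρ₀^t ρ₁^{-t}`, as a bounded operator. -/
def cocycle (ρ₀ ρ₁ : Weight H) (t : ℂ) : H →L[ℂ] H :=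
  boundedExtension (cpow ρ₀.op t) 1 (cpow ρ₁.op (-t))

/-- `t ↦ ρ^t X ρ^{-t}` is bounded and holomorphic in `|t| < 1/2`. -/
def IsArakiAnalytic (ρ : Weight H) (X : H →L[ℂ] H) : Prop :=
  ∃ Y : ℂ → H →L[ℂ] H, DifferentiableOn ℂ Y disc ∧ (∃ C : ℝ, ∀ t ∈ disc, ‖Y t‖ ≤ C) ∧
    ∀ t ∈ disc, IsBoundedExtension (cpow ρ.op t) X (cpow ρ.op (-t)) (Y t)

/-- The Araki norm `sup_{|t| < 1/2} ‖ρ^t X ρ^{-t}‖`. -/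
def arakiNorm (ρ : Weight H) (X : H →L[ℂ] H) : ℝ := ⨆ t : disc, ‖conj ρ t X‖


theorem isCompactOperator_of_summable {S : H →L[ℂ] H} {ι : Type*} (b : HilbertBasis ι ℂ H)
    (h : Summable fun i => ‖S (b i)‖ ^ 2) : IsCompactOperator S := by
  classical
  let F : Finset ι → H →L[ℂ] H := fun s => ∑ i ∈ s, (innerSL ℂ (b i)).smulRight (S (b i))
  have hF : ∀ s x, F s x = ∑ i ∈ s, inner ℂ (b i) x • S (b i) := by
    intro s x
    simp [F]
  have hFc : ∀ s, IsCompactOperator (F s) := by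
    intro s
    have : F s ∈ compactOperator (RingHom.id ℂ) H H := by
      refine Submodule.sum_mem _ fun i _ => ?_
      have h1 : IsCompactOperator (innerSL ℂ (b i)) :=
        isCompactOperator_of_locallyCompactSpace_dom _
      exact h1.clm_comp (ContinuousLinearMap.toSpanSingleton ℂ (S (b i)))
    exact this
  have hb : ∀ s x, ‖F s x‖ ^ 2 ≤ (∑ i ∈ s, ‖S (b i)‖ ^ 2) * ‖x‖ ^ 2 := by
    intro s x
    have h1 : ‖F s x‖ ≤ ∑ i ∈ s, ‖inner ℂ (b i) x‖ * ‖S (b i)‖ := by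
      rw [hF]
      refine (norm_sum_le _ _).trans (le_of_eq ?_)
      simp [norm_smul]
    have h2 := Finset.sum_mul_sq_le_sq_mul_sq s (fun i => ‖inner ℂ (b i) x‖) (fun i => ‖S (b i)‖)
    have h3 := b.orthonormal.sum_inner_products_le x (s := s)
    have h4 : ‖F s x‖ ^ 2 ≤ (∑ i ∈ s, ‖inner ℂ (b i) x‖ * ‖S (b i)‖) ^ 2 := by gcongr
    have h5 : 0 ≤ ∑ i ∈ s, ‖S (b i)‖ ^ 2 := Finset.sum_nonneg fun _ _ => sq_nonneg _
    nlinarith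
  have hlim : ∀ x, Filter.Tendsto (fun s => F s x) Filter.atTop (nhds (S x)) := by
    intro x
    have := (b.hasSum_repr x).mapL S
    simp only [map_smul, b.repr_apply_apply] at this
    simp only [hF]
    exact this
  have hcl : S ∈ closure {f : H →L[ℂ] H | IsCompactOperator f} := by
    rw [Metric.mem_closure_iff]
    intro ε hε
    obtain ⟨s, hs⟩ := summable_iff_vanishing_norm.1 h ((ε / 2) ^ 2) (by positivity)
    refine ⟨F s, hFc s, ?_⟩
    rw [dist_eq_norm]
    refine lt_of_le_of_lt (ContinuousLinearMap.opNorm_le_bound _ (by positivity : 0 ≤ ε / 2) ?_)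
      (by linarith)
    intro x
    refine le_of_tendsto (((hlim x).sub_const (F s x)).norm) ?_
    filter_upwards [Filter.eventually_ge_atTop s] with u hu
    have h1 : F u x - F s x = F (u \ s) x := by
      rw [hF, hF, hF, ← Finset.sum_sdiff hu]
      simp
    rw [h1]
    have h2 := hs (u \ s) Finset.sdiff_disjoint
    have h3 := (le_abs_self _).trans h2.le
    refine abs_le_of_sq_le_sq' ?_ (by positivity) |>.2
    rw [mul_pow]
    exact (hb _ _).trans (by gcongr)
  exact isClosed_setOfPred_isCompactOperator.closure_subset hcl

theorem isCompactOperator_of_hasFiniteTrace {T : H →L[ℂ] H} (hT : 0 ≤ T)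
    (h : HasFiniteTrace T) : IsCompactOperator T := by
  obtain ⟨w, b, hb⟩ := h
  have h1 : CFC.sqrt T * CFC.sqrt T = T := CFC.sqrt_mul_sqrt_self T
  have h2 : IsSelfAdjoint (CFC.sqrt T) := (CFC.sqrt_nonneg T).isSelfAdjoint
  have h3 : IsCompactOperator ((CFC.sqrt T : H →L[ℂ] H) : H → H) := by
    refine isCompactOperator_of_summable b (hb.congr fun i => ?_)
    conv_lhs => rw [← h1]
    rw [ContinuousLinearMap.mul_apply, ← ContinuousLinearMap.adjoint_inner_left,
      h2.adjoint_eq, inner_self_eq_norm_sq_to_K (𝕜 := ℂ)]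
    norm_cast
  rw [← h1]
  exact h3.comp_clm (CFC.sqrt T)

theorem Weight.nonneg (ρ : Weight H) : 0 ≤ ρ.op :=
  (ContinuousLinearMap.nonneg_iff_isPositive _).2 ρ.2.1

theorem Weight.isCompact (ρ : Weight H) : IsCompactOperator ρ.op := by
  obtain ⟨p, hp0, hp1, hp⟩ := ρ.2.2.2
  have h1 := isCompactOperator_of_hasFiniteTrace (T := ρ.op ^ p) CFC.rpow_nonneg hp
  have h2 : ρ.op = ρ.op ^ p * ρ.op ^ (1 - p) := by
    have hs : ∀ x ∈ spectrum ℝ ρ.op, 0 ≤ x := fun x hx => spectrum_nonneg_of_nonneg ρ.nonneg hx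
    rw [CFC.rpow_eq_cfc_real ρ.nonneg, CFC.rpow_eq_cfc_real ρ.nonneg, ← cfc_mul _ _ _
      (Real.continuous_rpow_const hp0.le).continuousOn
      (Real.continuous_rpow_const (by linarith)).continuousOn]
    conv_lhs => rw [← cfc_id' ℝ ρ.op ρ.nonneg.isSelfAdjoint]
    refine cfc_congr fun x hx => ?_
    rw [← Real.rpow_add_of_nonneg (hs x hx) hp0.le (by linarith)]
    simp
  rw [h2]
  exact h1.comp_clm _


theorem Weight.inner_op_left (ρ : Weight H) (x y : H) :
    inner ℂ (ρ.op x) y = inner ℂ x (ρ.op y) :=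
  ρ.nonneg.isSelfAdjoint.isSymmetric x y

/-- The eigenvectors of a weight are total. -/
theorem Weight.eq_zero_of_inner (ρ : Weight H) {x : H}
    (h : ∀ (μ : ℝ) (e : H), ρ.op e = (μ : ℂ) • e → inner ℂ e x = 0) : x = 0 := by
  have hsym : (ρ.op : H →ₗ[ℂ] H).IsSymmetric := ρ.nonneg.isSelfAdjoint.isSymmetric
  have hbot := ContinuousLinearMap.orthogonalComplement_iSup_eigenspaces_eq_bot ρ.isCompact hsym
  have hx : x ∈ (⨆ μ, Module.End.eigenspace (ρ.op : Module.End ℂ H) μ)ᗮ := by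
    rw [← Submodule.iInf_orthogonal, Submodule.mem_iInf]
    intro μ e he
    by_cases he0 : e = 0
    · simp [he0]
    have hre := hsym.conj_eigenvalue_eq_self
      (Module.End.hasEigenvalue_of_hasEigenvector ⟨he, he0⟩)
    refine h μ.re e ?_
    rw [Complex.conj_eq_iff_re.1 hre]
    exact Module.End.mem_eigenspace_iff.1 he
  rw [hbot] at hx
  simpa using hx

theorem Weight.funGraph_iff (ρ : Weight H) (f : ℝ → ℂ) (x y : H) :
    (x, y) ∈ funGraph f (bdd ρ.op) ↔ ∀ (μ : ℝ) (e : H), ρ.op e = (μ : ℂ) • e →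
      inner ℂ e y = f μ * inner ℂ e x :=
  ⟨fun h μ e he => h μ ⟨e, trivial⟩ he, fun h μ e he => h μ e he⟩

theorem Weight.graph_spectralFun (ρ : Weight H) (f : ℝ → ℂ) :
    (spectralFun f (bdd ρ.op)).graph = funGraph f (bdd ρ.op) := by
  refine Submodule.toLinearPMap_graph_eq _ ?_
  rintro ⟨x, y⟩ hp (rfl : x = 0)
  rw [ρ.funGraph_iff] at hp
  exact ρ.eq_zero_of_inner fun μ e he => by simpa using hp μ e he

theorem Weight.eigen_mem (ρ : Weight H) (f : ℝ → ℂ) (μ : ℝ) (e : H)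
    (he : ρ.op e = (μ : ℂ) • e) : (e, f μ • e) ∈ (spectralFun f (bdd ρ.op)).graph := by
  rw [ρ.graph_spectralFun, ρ.funGraph_iff]
  intro ν g hg
  rw [inner_smul_right]
  by_cases h : ν = μ
  · rw [h]
  have h1 := ρ.inner_op_left g e
  rw [hg, he, inner_smul_left, inner_smul_right] at h1
  have h2 : ((ν : ℂ) - μ) * inner ℂ g e = 0 := by
    rw [sub_mul, sub_eq_zero]
    simpa using h1
  rcases mul_eq_zero.1 h2 with h3 | h3
  · exact absurd (by exact_mod_cast sub_eq_zero.1 h3) h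
  · simp [h3]

set_option linter.unusedSectionVars false in
theorem isBoundedExtension_iff {A : H →ₗ.[ℂ] H} {X : H →L[ℂ] H} {B : H →ₗ.[ℂ] H} {Y : H →L[ℂ] H} :
    IsBoundedExtension A X B Y ↔ ∀ x y, (x, y) ∈ B.graph → (X y, Y x) ∈ A.graph := by
  constructor
  · intro h x y hxy
    obtain ⟨x', hx1, hx2⟩ := (LinearPMap.mem_graph_iff _).1 hxy
    obtain ⟨hd, he⟩ := h x'
    simp only at hx1 hx2
    subst hx1 hx2
    rw [LinearPMap.mem_graph_iff]
    exact ⟨⟨_, hd⟩, rfl, he⟩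
  · intro h x
    obtain ⟨z, hz1, hz2⟩ := (LinearPMap.mem_graph_iff _).1 (h _ _ (B.mem_graph x))
    simp only at hz1 hz2
    refine ⟨hz1 ▸ z.2, ?_⟩
    rw [← hz2]
    congr 1
    exact Subtype.ext hz1.symm

/-- The bounded operator given by `ρ₀^t X ρ₁^{-t}` is unique. -/
theorem Weight.ext_unique {A : H →ₗ.[ℂ] H} {X : H →L[ℂ] H} (ρ : Weight H) {z : ℂ}
    {Y Z : H →L[ℂ] H} (hY : IsBoundedExtension A X (cpow ρ.op z) Y)
    (hZ : IsBoundedExtension A X (cpow ρ.op z) Z) : Y = Z := by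
  rw [isBoundedExtension_iff] at hY hZ
  have key : ∀ (μ : ℝ) (e : H), ρ.op e = (μ : ℂ) • e → Y e = Z e := fun μ e he =>
    LinearPMap.mem_graph_snd_inj _ (hY _ _ (ρ.eigen_mem _ μ e he))
      (hZ _ _ (ρ.eigen_mem _ μ e he)) rfl
  have h0 : ContinuousLinearMap.adjoint (Y - Z) = 0 := by
    ext x
    refine ρ.eq_zero_of_inner fun μ e he => ?_
    rw [ContinuousLinearMap.adjoint_inner_right]
    simp [key μ e he]
  rw [← sub_eq_zero, ← ContinuousLinearMap.adjoint_adjoint (Y - Z), h0, map_zero]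

theorem boundedExtension_eq {A : H →ₗ.[ℂ] H} {X : H →L[ℂ] H} (ρ : Weight H) {z : ℂ}
    {Y : H →L[ℂ] H} (hY : IsBoundedExtension A X (cpow ρ.op z) Y) :
    boundedExtension A X (cpow ρ.op z) = Y := by
  have h : ∃ Y, IsBoundedExtension A X (cpow ρ.op z) Y := ⟨Y, hY⟩
  rw [boundedExtension, dif_pos h]
  exact ρ.ext_unique h.choose_spec hY

theorem isBoundedExtension_zero (A B : H →ₗ.[ℂ] H) : IsBoundedExtension A 0 B 0 := by
  rw [isBoundedExtension_iff]
  intro x y _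
  exact A.graph.zero_mem

theorem IsBoundedExtension.add {A B : H →ₗ.[ℂ] H} {X X' Y Y' : H →L[ℂ] H}
    (h : IsBoundedExtension A X B Y) (h' : IsBoundedExtension A X' B Y') :
    IsBoundedExtension A (X + X') B (Y + Y') := by
  rw [isBoundedExtension_iff] at *
  intro x y hxy
  exact A.graph.add_mem (h x y hxy) (h' x y hxy)

theorem IsBoundedExtension.smul {A B : H →ₗ.[ℂ] H} {X Y : H →L[ℂ] H} (c : ℂ)
    (h : IsBoundedExtension A X B Y) : IsBoundedExtension A (c • X) B (c • Y) := by
  rw [isBoundedExtension_iff] at *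
  intro x y hxy
  exact A.graph.smul_mem c (h x y hxy)

theorem isBoundedExtension_at_zero (ρ : Weight H) (X : H →L[ℂ] H) :
    IsBoundedExtension (cpow ρ.op 0) X (cpow ρ.op (-0)) X := by
  have h0 : ∀ x y, (x, y) ∈ (cpow ρ.op 0).graph ↔ y = x := by
    intro x y
    rw [cpow, ρ.graph_spectralFun, ρ.funGraph_iff]
    constructor
    · intro h
      refine sub_eq_zero.1 (ρ.eq_zero_of_inner fun μ e he => ?_)
      simpa [inner_sub_right, sub_eq_zero] using h μ e he
    · rintro rfl μ e _
      simp
  rw [isBoundedExtension_iff, neg_zero]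
  intro x y hxy
  rw [h0] at hxy ⊢
  rw [hxy]

theorem zero_mem_disc : (0 : ℂ) ∈ disc := by simp [disc]

variable (ρ : Weight H)

theorem IsArakiAnalytic.isBoundedExtension {ρ : Weight H} {X : H →L[ℂ] H}
    (h : IsArakiAnalytic ρ X) {t : ℂ} (ht : t ∈ disc) :
    IsBoundedExtension (cpow ρ.op t) X (cpow ρ.op (-t)) (conj ρ t X) := by
  obtain ⟨Y, -, -, hY⟩ := h
  rw [conj, boundedExtension_eq ρ (hY t ht)]
  exact hY t ht

theorem IsArakiAnalytic.bddAbove {ρ : Weight H} {X : H →L[ℂ] H} (h : IsArakiAnalytic ρ X) :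
    BddAbove (Set.range fun t : disc => ‖conj ρ t X‖) := by
  obtain ⟨Y, -, ⟨C, hC⟩, hY⟩ := h
  refine ⟨C, ?_⟩
  rintro _ ⟨t, rfl⟩
  simp only
  rw [conj, boundedExtension_eq ρ (hY t t.2)]
  exact hC t t.2

theorem conj_zero (X : H →L[ℂ] H) : conj ρ 0 X = X :=
  boundedExtension_eq ρ (isBoundedExtension_at_zero ρ X)

theorem conj_add {X Y : H →L[ℂ] H} (hX : IsArakiAnalytic ρ X) (hY : IsArakiAnalytic ρ Y)
    {t : ℂ} (ht : t ∈ disc) : conj ρ t (X + Y) = conj ρ t X + conj ρ t Y :=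
  boundedExtension_eq ρ ((hX.isBoundedExtension ht).add (hY.isBoundedExtension ht))

theorem conj_smul {X : H →L[ℂ] H} (c : ℂ) (hX : IsArakiAnalytic ρ X)
    {t : ℂ} (ht : t ∈ disc) : conj ρ t (c • X) = c • conj ρ t X :=
  boundedExtension_eq ρ ((hX.isBoundedExtension ht).smul c)

/-- The bounded operators `X` such that `ρ^t X ρ^{-t}` is bounded and holomorphic in
`|t| < 1/2`, as a linear space. -/
def arakiSubmodule : Submodule ℂ (H →L[ℂ] H) where
  carrier := {X | IsArakiAnalytic ρ X}
  add_mem' := by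
    rintro X X' ⟨Y, hd, ⟨C, hC⟩, hY⟩ ⟨Y', hd', ⟨C', hC'⟩, hY'⟩
    exact ⟨fun t => Y t + Y' t, hd.add hd', ⟨C + C', fun t ht =>
      (norm_add_le _ _).trans (add_le_add (hC t ht) (hC' t ht))⟩,
      fun t ht => (hY t ht).add (hY' t ht)⟩
  zero_mem' := ⟨fun _ => 0, differentiableOn_const 0, ⟨0, by simp⟩,
    fun t _ => isBoundedExtension_zero _ _⟩
  smul_mem' := by
    rintro c X ⟨Y, hd, ⟨C, hC⟩, hY⟩
    exact ⟨fun t => c • Y t, hd.const_smul c, ⟨‖c‖ * C, fun t ht => by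
      rw [norm_smul]
      exact mul_le_mul_of_nonneg_left (hC t ht) (norm_nonneg c)⟩, fun t ht => (hY t ht).smul c⟩

/-- The space of the `X` such that `ρ^t X ρ^{-t}` is bounded and holomorphic in `|t| < 1/2`; it
carries the Araki norm, not the operator norm. -/
def ArakiSpace : Type _ := arakiSubmodule ρ

namespace ArakiSpace

instance : AddCommGroup (ArakiSpace ρ) := inferInstanceAs (AddCommGroup (arakiSubmodule ρ))

instance : Module ℂ (ArakiSpace ρ) := inferInstanceAs (Module ℂ (arakiSubmodule ρ))

variable {ρ} in
/-- An element of the space as a bounded operator. -/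
def op (X : ArakiSpace ρ) : H →L[ℂ] H := X.1

instance : Norm (ArakiSpace ρ) := ⟨fun X => arakiNorm ρ X.op⟩

theorem normedSpaceCore : NormedSpace.Core ℂ (ArakiSpace ρ) where
  norm_nonneg X := Real.iSup_nonneg fun _ => norm_nonneg _
  norm_smul c X := by
    change ⨆ t : disc, ‖conj ρ t (c • X.op)‖ = ‖c‖ * ⨆ t : disc, ‖conj ρ t X.op‖
    rw [Real.mul_iSup_of_nonneg (norm_nonneg c)]
    refine iSup_congr fun t => ?_
    rw [conj_smul ρ (X := X.op) c X.2 t.2, norm_smul]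
  norm_triangle X Y := by
    change ⨆ t : disc, ‖conj ρ t (X.op + Y.op)‖ ≤
      (⨆ t : disc, ‖conj ρ t X.op‖) + ⨆ t : disc, ‖conj ρ t Y.op‖
    have : Nonempty disc := ⟨⟨0, zero_mem_disc⟩⟩
    refine ciSup_le fun t => ?_
    rw [conj_add ρ (X := X.op) (Y := Y.op) X.2 Y.2 t.2]
    exact (norm_add_le _ _).trans (add_le_add
      (le_ciSup (IsArakiAnalytic.bddAbove X.2) t) (le_ciSup (IsArakiAnalytic.bddAbove Y.2) t))
  norm_eq_zero_iff X := by
    change ⨆ t : disc, ‖conj ρ t X.op‖ = 0 ↔ X = 0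
    constructor
    · intro h
      have h1 := le_ciSup (IsArakiAnalytic.bddAbove X.2) ⟨0, zero_mem_disc⟩
      simp only [conj_zero] at h1
      have h2 : ‖X.op‖ ≤ 0 := h1.trans_eq h
      exact Subtype.ext (norm_le_zero_iff.1 h2)
    · rintro rfl
      have h1 : ∀ t : disc, ‖conj ρ t (0 : H →L[ℂ] H)‖ = 0 := fun t => by
        rw [conj, boundedExtension_eq ρ (isBoundedExtension_zero _ _), norm_zero]
      exact (iSup_congr h1).trans Real.iSup_const_zero

instance : NormedAddCommGroup (ArakiSpace ρ) := NormedAddCommGroup.ofCore (normedSpaceCore ρ)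

instance : NormedSpace ℂ (ArakiSpace ρ) := NormedSpace.ofCore (normedSpaceCore ρ)

end ArakiSpace

/-- The real subspace of the self-adjoint elements, with the Araki norm: the model space of the
chart around `ρ`. -/
def saArakiSpace : Submodule ℝ (ArakiSpace ρ) where
  carrier := {X | IsSelfAdjoint X.op}
  add_mem' := fun {X Y} hX hY => IsSelfAdjoint.add (show IsSelfAdjoint X.op from hX) hY
  zero_mem' := IsSelfAdjoint.zero (H →L[ℂ] H)
  smul_mem' := fun c X hX => by
    change IsSelfAdjoint ((c : ℂ) • X.op)
    exact IsSelfAdjoint.smul (Complex.conj_ofReal c) hX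

/-- The neighbourhood of `ρ`: the points `ρ_X = exp (-H₀ - X)` with `X` self-adjoint and
`ρ^t X ρ^{-t}` bounded and holomorphic in `|t| < 1/2`. -/
def hood : Set (Weight H) := {σ | ∃ X : saArakiSpace ρ, bdd σ.op = perturb ρ.op X.1.op}

end Operators

/-- A Banach manifold structure (real analytic, in particular smooth) on a topological space `M`:
charts that are homeomorphisms from open sets covering `M` onto open subsets of real Banach spaces
`E i`, with real analytic changes of charts. -/
structure BanachAtlas (M : Type*) [TopologicalSpace M] {ι : Type*} (E : ι → Type*)
    [∀ i, NormedAddCommGroup (E i)] [∀ i, NormedSpace ℝ (E i)] where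
  complete : ∀ i, CompleteSpace (E i)
  chart : ∀ i, OpenPartialHomeomorph M (E i)
  cover : ∀ x, ∃ i, x ∈ (chart i).source
  compatible : ∀ i j, ContDiffOn ℝ ω (chart j ∘ (chart i).symm) ((chart i).symm.trans (chart j)).source

end

end Araki

/-! A weight is compact and injective, so it has an orthonormal basis of eigenvectors with positive
eigenvalues, and each function of it, bounded or not, multiplies coordinates. Statements about
unbounded products thereby become statements about graphs or about bounded powers: for `0 ≤ t.re`,
`ρ^t X σ^{-t}` extends to `Y` exactly when `Y σ^t = ρ^t X`.

Cocycle. If `σ ≤ C ρ`, the Löwner–Heinz inequality with exponent `2s ≤ 1` gives `‖σ^s x‖ ≤ C ‖ρ^s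
x‖` for `0 ≤ s ≤ 1/2`. So `ρ^t x ↦ σ^t x` extends from the dense range of `ρ^t` to a bounded
operator; taking adjoints covers negative real parts (`exists_cocycle`). Its matrix elements in the
two eigenbases are constants times `l^t l'^{-t}`, and boundedness upgrades this to holomorphy in
norm (`differentiableOn_of_matrix`). Conjugation by the cocycle identifies the Araki spaces of
nearby weights, with equivalent norms.

Perturbation. `H₀ + X` has compact resolvent by a Neumann series, so it has an eigenbasis `f` with
eigenvalues `ν`. Let `V` solve `V' = -V ρ^s X ρ^{-s}`, `V 0 = 1`, by a Dyson series. Then `V_s ρ^s f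
= e^{-sν} f`, that is, `V_s = ρ_X^s ρ^{-s}`, with bounds on `V_s` and its inverse uniform for `0 ≤ s
< 1/2` (`exists_intertwiner`). Taking `s = p/2` bounds the trace of `ρ_X^p` by a multiple of that of
`ρ^p`, so `ρ_X` is a weight; letting `s` tend to `1/2` compares the quadratic forms and shows that
it is nearby `ρ` (`exists_perturb`).

Manifold. A weight is determined by its Hamiltonian, and that of `ρ_X` is `H₀ + X`. If two charts
overlap, their centres are nearby, the model spaces coincide, and the change of charts is a
continuous linear identification followed by a translation. Openness, the Hausdorff property and
analyticity follow. Completeness of the model spaces is the Weierstrass theorem on uniform limits of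
holomorphic functions. -/

namespace Araki

open scoped ContDiff InnerProductSpace
open Filter Topology

noncomputable section

universe u

/-! ### Diagonal operators in a Hilbert basis -/

section Diagonal

variable {H : Type u} [NormedAddCommGroup H] [InnerProductSpace ℂ H] {ι : Type*}

theorem basis_ext (b : HilbertBasis ι ℂ H) {x y : H}
    (h : ∀ i, inner ℂ (b i) x = inner ℂ (b i) y) : x = y :=
  b.repr.injective (lp.ext (funext fun i => by simpa [b.repr_apply_apply] using h i))

theorem norm_le_of_coord (b : HilbertBasis ι ℂ H) {x y : H} {C : ℝ} (hC : 0 ≤ C)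
    (h : ∀ i, ‖inner ℂ (b i) x‖ ≤ C * ‖inner ℂ (b i) y‖) : ‖x‖ ≤ C * ‖y‖ := by
  have h1 : ‖b.repr x‖ ≤ ‖b.repr ((C : ℂ) • y)‖ := by
    refine lp.norm_mono (by simp) fun i => ?_
    simp only [b.repr_apply_apply, inner_smul_right, norm_mul, Complex.norm_real,
      Real.norm_of_nonneg hC]
    exact h i
  simpa [norm_smul, Real.norm_of_nonneg hC] using h1

theorem dense_span_basis (b : HilbertBasis ι ℂ H) :
    Dense (Submodule.span ℂ (Set.range b) : Set H) := by
  rw [dense_iff_closure_eq, ← Submodule.topologicalClosure_coe, b.dense_span]; rfl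

theorem clm_ext_basis (b : HilbertBasis ι ℂ H) {A B : H →L[ℂ] H} (h : ∀ i, A (b i) = B (b i)) :
    A = B := by
  refine ContinuousLinearMap.ext_on (dense_span_basis b) ?_
  rintro _ ⟨i, rfl⟩
  exact h i

theorem exists_diag (b : HilbertBasis ι ℂ H) {c : ι → ℂ} {C : ℝ} (hC : ∀ i, ‖c i‖ ≤ C) :
    ∃ D : H →L[ℂ] H, ∀ x i, inner ℂ (b i) (D x) = c i * inner ℂ (b i) x := by
  have hm : ∀ x : H, Memℓp (fun i => c i * inner ℂ (b i) x) 2 := by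
    intro x
    have h1 : Memℓp (fun i => inner ℂ (b i) x) 2 := by
      have := lp.memℓp (b.repr x)
      rwa [show (b.repr x : ι → ℂ) = fun i => inner ℂ (b i) x from
        funext fun i => b.repr_apply_apply x i] at this
    refine (h1.const_mul (C : ℂ)).mono' fun i => ?_
    rw [norm_mul, norm_mul, Complex.norm_real]
    exact mul_le_mul_of_nonneg_right ((hC i).trans (le_abs_self C)) (norm_nonneg _)
  have hr : ∀ (f : ι → ℂ) (hf : Memℓp f 2) i, inner ℂ (b i) (b.repr.symm ⟨f, hf⟩) = f i := by
    intro f hf i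
    rw [← b.repr_apply_apply, LinearIsometryEquiv.apply_symm_apply]
  let L : H →ₗ[ℂ] H :=
    { toFun := fun x => b.repr.symm ⟨_, hm x⟩
      map_add' := fun x y => basis_ext b fun i => by
        rw [inner_add_right, hr, hr, hr, inner_add_right, mul_add]
      map_smul' := fun a x => basis_ext b fun i => by
        rw [RingHom.id_apply, inner_smul_right, hr, hr, inner_smul_right]; ring }
  refine ⟨L.mkContinuous (max C 0) fun x => norm_le_of_coord b (le_max_right _ _) fun i => ?_,
    fun x i => hr _ (hm x) i⟩
  rw [show inner ℂ (b i) (L x) = _ from hr _ (hm x) i, norm_mul]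
  exact mul_le_mul_of_nonneg_right ((hC i).trans (le_max_left _ _)) (norm_nonneg _)

open Classical in
/-- The bounded diagonal operator with entries `c` in the basis `b` (`0` if `c` is unbounded). -/
def diag (b : HilbertBasis ι ℂ H) (c : ι → ℂ) : H →L[ℂ] H :=
  if h : ∃ D : H →L[ℂ] H, ∀ x i, inner ℂ (b i) (D x) = c i * inner ℂ (b i) x then h.choose else 0

theorem inner_diag (b : HilbertBasis ι ℂ H) {c : ι → ℂ} {C : ℝ} (hC : ∀ i, ‖c i‖ ≤ C) (i : ι)
    (x : H) : inner ℂ (b i) (diag b c x) = c i * inner ℂ (b i) x := by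
  have h := exists_diag b hC
  rw [diag, dif_pos h]
  exact h.choose_spec x i

theorem diag_basis (b : HilbertBasis ι ℂ H) {c : ι → ℂ} {C : ℝ} (hC : ∀ i, ‖c i‖ ≤ C) (i : ι) :
    diag b c (b i) = c i • b i := by
  classical
  refine basis_ext b fun j => ?_
  rw [inner_diag b hC, inner_smul_right]
  have := orthonormal_iff_ite.1 b.orthonormal j i
  rw [this]
  split_ifs with h
  · rw [h]
  · simp

theorem norm_diag_le (b : HilbertBasis ι ℂ H) {c : ι → ℂ} {C : ℝ} (hC0 : 0 ≤ C)
    (hC : ∀ i, ‖c i‖ ≤ C) : ‖diag b c‖ ≤ C := by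
  refine ContinuousLinearMap.opNorm_le_bound _ hC0 fun x => norm_le_of_coord b hC0 fun i => ?_
  rw [inner_diag b hC, norm_mul]
  exact mul_le_mul_of_nonneg_right (hC i) (norm_nonneg _)

/-- Real eigenvalues make the form symmetric on basis vectors; density of their span extends this to
one argument at a time. -/
theorem inner_eq_conj_of_basis {A : H →L[ℂ] H} (b : HilbertBasis ι ℂ H) {ν : ι → ℝ}
    (h : ∀ i, A (b i) = (ν i : ℂ) • b i) (x y : H) : inner ℂ (A x) y = inner ℂ x (A y) := by
  have h1 : ∀ i j, inner ℂ (A (b i)) (b j) = inner ℂ (b i) (A (b j)) := by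
    classical
    intro i j
    rw [h, h, inner_smul_left, inner_smul_right, orthonormal_iff_ite.1 b.orthonormal i j]
    split_ifs with hij
    · simp [hij]
    · simp
  have h2 : ∀ i y, inner ℂ (A (b i)) y = inner ℂ (b i) (A y) := by
    intro i y
    have : innerSL ℂ (A (b i)) = (innerSL ℂ (b i)).comp A := by
      refine ContinuousLinearMap.ext_on (dense_span_basis b) ?_
      rintro _ ⟨j, rfl⟩
      simpa using h1 i j
    simpa using congrArg (fun f => f y) this
  have h3 : innerSL ℂ y ∘L A = innerSL ℂ (A y) := by
    refine ContinuousLinearMap.ext_on (dense_span_basis b) ?_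
    rintro _ ⟨j, rfl⟩
    have := congrArg (starRingEnd ℂ) (h2 j y)
    simpa using this
  have := congrArg (fun f => starRingEnd ℂ (f x)) h3
  simpa using this

theorem inner_basis_apply {A : H →L[ℂ] H} (b : HilbertBasis ι ℂ H) {ν : ι → ℝ}
    (h : ∀ i, A (b i) = (ν i : ℂ) • b i) (i : ι) (x : H) :
    inner ℂ (b i) (A x) = ν i * inner ℂ (b i) x := by
  rw [← inner_eq_conj_of_basis b h, h, inner_smul_left, Complex.conj_ofReal]

end Diagonal

/-! ### Spectral calculus in a basis of eigenvectors -/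

section Eigenbasis

variable {H : Type u} [NormedAddCommGroup H] [InnerProductSpace ℂ H] {ι : Type*}

theorem mem_graph_bdd {A : H →L[ℂ] H} {x y : H} : (x, y) ∈ (bdd A).graph ↔ A x = y := by
  rw [LinearPMap.mem_graph_iff]
  constructor
  · rintro ⟨z, hz, h⟩
    simp only at hz h
    rw [← h, ← hz]; rfl
  · intro h
    exact ⟨⟨x, trivial⟩, rfl, h⟩

theorem bdd_injective : Function.Injective (bdd : (H →L[ℂ] H) → _) := by
  intro A B h
  ext x
  have : (x, A x) ∈ (bdd B).graph := by rw [← h]; exact mem_graph_bdd.2 rfl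
  exact (mem_graph_bdd.1 this).symm

/-- `b` is an orthonormal basis of eigenvectors of the symmetric operator `T`, with eigenvalues
`ν`. -/
structure IsEigenbasis (T : H →ₗ.[ℂ] H) (b : HilbertBasis ι ℂ H) (ν : ι → ℝ) : Prop where
  mem : ∀ i, (b i, (ν i : ℂ) • b i) ∈ T.graph
  symm : ∀ x y x' y', (x, y) ∈ T.graph → (x', y') ∈ T.graph → inner ℂ x y' = inner ℂ y x'

theorem isEigenbasis_bdd {A : H →L[ℂ] H} {b : HilbertBasis ι ℂ H} {ν : ι → ℝ}
    (h : ∀ i, A (b i) = (ν i : ℂ) • b i) : IsEigenbasis (bdd A) b ν where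
  mem i := mem_graph_bdd.2 (h i)
  symm x y x' y' h1 h2 := by
    rw [mem_graph_bdd] at h1 h2
    rw [← h1, ← h2, inner_eq_conj_of_basis b h]

namespace IsEigenbasis

variable {T : H →ₗ.[ℂ] H} {b : HilbertBasis ι ℂ H} {ν : ι → ℝ}

theorem inner_of_mem (hT : IsEigenbasis T b ν) {x y : H} (h : (x, y) ∈ T.graph) (i : ι) :
    inner ℂ (b i) y = ν i * inner ℂ (b i) x := by
  rw [hT.symm _ _ _ _ (hT.mem i) h, inner_smul_left, Complex.conj_ofReal]

/-- It is enough to test on the basis: an eigenvector for `μ` has nonzero coordinates only at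
indices with `ν i = μ`, so its inner products expand into the tested ones. -/
theorem mem_funGraph (hT : IsEigenbasis T b ν) (f : ℝ → ℂ) {x y : H} :
    (x, y) ∈ funGraph f T ↔ ∀ i, inner ℂ (b i) y = f (ν i) * inner ℂ (b i) x := by
  constructor
  · intro h i
    obtain ⟨z, hz1, hz2⟩ := (LinearPMap.mem_graph_iff _).1 (hT.mem i)
    simp only at hz1 hz2
    have := h (ν i) z (by rw [hz2, hz1])
    rwa [hz1] at this
  · intro h μ e he
    have h1 : ∀ i, (ν i : ℂ) * inner ℂ (b i) (e : H) = μ * inner ℂ (b i) (e : H) := by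
      intro i
      have := hT.inner_of_mem (T.mem_graph e) i
      rw [he, inner_smul_right] at this
      exact this.symm
    simp only
    rw [← b.tsum_inner_mul_inner, ← b.tsum_inner_mul_inner, ← tsum_mul_left]
    refine tsum_congr fun i => ?_
    rw [h i]
    by_cases h0 : inner ℂ (b i) (e : H) = 0
    · have : inner ℂ (e : H) (b i) = 0 := by rw [← inner_conj_symm, h0, map_zero]
      simp [this]
    · have h2 := mul_right_cancel₀ h0 (h1 i)
      rw [show ν i = μ by exact_mod_cast h2]
      ring

theorem mem_spectralFun (hT : IsEigenbasis T b ν) (f : ℝ → ℂ) {x y : H} :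
    (x, y) ∈ (spectralFun f T).graph ↔ ∀ i, inner ℂ (b i) y = f (ν i) * inner ℂ (b i) x := by
  rw [spectralFun, Submodule.toLinearPMap_graph_eq, hT.mem_funGraph]
  rintro ⟨x, y⟩ hp (rfl : x = 0)
  rw [hT.mem_funGraph] at hp
  exact basis_ext b fun i => by simpa using hp i

theorem spectralFun (hT : IsEigenbasis T b ν) (g : ℝ → ℝ) :
    IsEigenbasis (spectralFun (fun x => (g x : ℂ)) T) b (fun i => g (ν i)) where
  mem i := by
    classical
    rw [hT.mem_spectralFun]
    intro j
    rw [inner_smul_right, orthonormal_iff_ite.1 b.orthonormal j i]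
    split_ifs with h
    · rw [h]
    · simp
  symm x y x' y' h h' := by
    rw [hT.mem_spectralFun] at h h'
    rw [← b.tsum_inner_mul_inner, ← b.tsum_inner_mul_inner]
    refine tsum_congr fun i => ?_
    rw [h' i, ← inner_conj_symm y (b i), h i, map_mul, Complex.conj_ofReal, inner_conj_symm]
    ring

theorem spectralFun_eq_bdd (hT : IsEigenbasis T b ν) (f : ℝ → ℂ) {A : H →L[ℂ] H}
    (hA : ∀ i x, inner ℂ (b i) (A x) = f (ν i) * inner ℂ (b i) x) :
    Araki.spectralFun f T = bdd A := by
  refine LinearPMap.eq_of_eq_graph (Submodule.ext ?_)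
  rintro ⟨x, y⟩
  rw [hT.mem_spectralFun, mem_graph_bdd]
  constructor
  · intro h
    exact basis_ext b fun i => by rw [h i, hA]
  · rintro rfl i
    exact hA i x

end IsEigenbasis

/-- Hilbert bases of the eigenspaces, kernel included, are glued together; the spectral theorem for
compact operators says that nothing is orthogonal to all of them. -/
theorem exists_eigenbasis [CompleteSpace H] {R : H →L[ℂ] H} (hc : IsCompactOperator R) (hs : IsSelfAdjoint R) :
    ∃ (ι : Type u) (b : HilbertBasis ι ℂ H) (r : ι → ℝ), ∀ i, R (b i) = (r i : ℂ) • b i := by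
  have hsym : (R : H →ₗ[ℂ] H).IsSymmetric := hs.isSymmetric
  have hbot := ContinuousLinearMap.orthogonalComplement_iSup_eigenspaces_eq_bot hc hsym
  let E : ℂ → Submodule ℂ H := fun μ => Module.End.eigenspace (R : Module.End ℂ H) μ
  have hcl : ∀ μ, CompleteSpace (E μ) := fun μ => by
    have : IsClosed (E μ : Set H) := by
      have : (E μ : Set H) = {x | R x = μ • x} := by
        ext x; exact Module.End.mem_eigenspace_iff
      rw [this]
      exact isClosed_eq R.continuous (continuous_const_smul μ)
    exact this.completeSpace_coe
  choose w b hb using fun μ => exists_hilbertBasis ℂ (E μ)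
  let v : (Σ μ, w μ) → H := fun a => (b a.1 a.2 : H)
  have hv : Orthonormal ℂ v :=
    hsym.orthogonalFamily_eigenspaces.orthonormal_sigma_orthonormal fun μ => (b μ).orthonormal
  have hR : ∀ a, R (v a) = a.1 • v a := fun a =>
    Module.End.mem_eigenspace_iff.1 (b a.1 a.2).2
  have hsp : (Submodule.span ℂ (Set.range v))ᗮ = ⊥ := by
    rw [eq_bot_iff, ← hbot, ← Submodule.iInf_orthogonal]
    intro x hx
    rw [Submodule.mem_iInf]
    intro μ e he
    have h1 : innerSL ℂ x ∘L (E μ).subtypeL = 0 := by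
      refine ContinuousLinearMap.ext_on (s := Set.range (b μ)) ?_ ?_
      · rw [dense_iff_closure_eq, ← Submodule.topologicalClosure_coe, (b μ).dense_span]; rfl
      · rintro _ ⟨i, rfl⟩
        have := hx (v ⟨μ, i⟩) (Submodule.subset_span ⟨_, rfl⟩)
        rw [← inner_conj_symm, map_eq_zero] at this
        simpa [v] using this
    have h2 : inner ℂ x e = 0 := congrArg (fun f => f ⟨e, he⟩) h1
    rw [← inner_conj_symm, h2, map_zero]
  refine ⟨_, HilbertBasis.mkOfOrthogonalEqBot hv hsp, fun a => a.1.re, fun a => ?_⟩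
  rw [HilbertBasis.coe_mkOfOrthogonalEqBot, hR]
  have h0 : v a ≠ 0 := hv.ne_zero a
  have hre := hsym.conj_eigenvalue_eq_self
    (Module.End.hasEigenvalue_of_hasEigenvector ⟨(b a.1 a.2).2, h0⟩)
  rw [Complex.conj_eq_iff_re.1 hre]

end Eigenbasis

/-! ### The trace condition and the diagonal form of weights -/

section

section Trace

variable {H : Type u} [NormedAddCommGroup H] [InnerProductSpace ℂ H]

theorem hasSum_sq_norm_inner {ι : Type*} (b : HilbertBasis ι ℂ H) (x : H) :
    HasSum (fun i => ‖inner ℂ (b i) x‖ ^ 2) (‖x‖ ^ 2) := by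
  have h := Complex.hasSum_re (b.hasSum_inner_mul_inner x x)
  rw [inner_self_eq_norm_sq_to_K] at h
  convert h using 1
  · ext i
    rw [← inner_conj_symm x, mul_comm, Complex.mul_conj, Complex.normSq_eq_norm_sq,
      Complex.ofReal_re]
  · norm_cast

/-- The Hilbert–Schmidt norms of an operator and of its adjoint, computed in any two orthonormal
bases, are finite together. -/
theorem summable_sq_norm_of_adjoint {ι κ : Type*} (b : HilbertBasis ι ℂ H)
    (b' : HilbertBasis κ ℂ H) {A B : H →L[ℂ] H} (hAB : ∀ x y, inner ℂ (A x) y = inner ℂ x (B y))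
    (h : Summable fun i => ‖A (b i)‖ ^ 2) : Summable fun j => ‖B (b' j)‖ ^ 2 := by
  have hF : Summable fun q : ι × κ => ‖inner ℂ (b' q.2) (A (b q.1))‖ ^ 2 := by
    rw [summable_prod_of_nonneg fun _ => sq_nonneg _]
    exact ⟨fun i => (hasSum_sq_norm_inner b' (A (b i))).summable,
      h.congr fun i => (hasSum_sq_norm_inner b' (A (b i))).tsum_eq.symm⟩
  have hG : Summable fun q : κ × ι => ‖inner ℂ (b' q.1) (A (b q.2))‖ ^ 2 := hF.prod_symm
  rw [summable_prod_of_nonneg fun _ => sq_nonneg _] at hG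
  refine hG.2.congr fun j => ?_
  rw [← (hasSum_sq_norm_inner b (B (b' j))).tsum_eq]
  refine tsum_congr fun i => ?_
  rw [← hAB, ← inner_conj_symm, RCLike.norm_conj]

end Trace

variable {H : Type u} [NormedAddCommGroup H] [InnerProductSpace ℂ H] [CompleteSpace H]

/-- The identity is clear for constants and for the identity function, is stable under sums and
products, and survives uniform limits, so Stone–Weierstrass gives it for every continuous function.
-/
theorem cfc_apply_eigenvector {a : H →L[ℂ] H} (ha : IsSelfAdjoint a) {e : H} {μ : ℝ} (he0 : e ≠ 0)
    (he : a e = (μ : ℂ) • e) {f : ℝ → ℝ} (hf : ContinuousOn f (spectrum ℝ a)) :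
    cfc f a e = (f μ : ℂ) • e := by
  have hμ : μ ∈ spectrum ℝ a := by
    rw [spectrum.mem_iff]
    intro hu
    obtain ⟨c, hc⟩ := hu.exists_left_inv
    have h1 := congrArg (fun T : H →L[ℂ] H => T e) hc
    have h2 : (algebraMap ℝ (H →L[ℂ] H) μ - a) e = 0 := by
      rw [sub_apply, he, Algebra.algebraMap_eq_smul_one]
      simp
    change c ((algebraMap ℝ (H →L[ℂ] H) μ - a) e) = e at h1
    rw [h2, map_zero] at h1
    exact he0 h1.symm
  have key : ∀ g : C(spectrum ℝ a, ℝ), cfcHom (R := ℝ) ha g e = (g ⟨μ, hμ⟩ : ℂ) • e := by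
    intro g
    refine ContinuousMap.induction_on_of_compact
      (p := fun g => cfcHom (R := ℝ) ha g e = (g ⟨μ, hμ⟩ : ℂ) • e) ?_ ?_ ?_ ?_ ?_ ?_ g
    · intro r
      have : (ContinuousMap.const (spectrum ℝ a) r) = algebraMap ℝ _ r := rfl
      rw [this, AlgHomClass.commutes, Algebra.algebraMap_eq_smul_one]
      simp
    · rw [cfcHom_id ha, he]; rfl
    · rw [star_trivial, cfcHom_id ha, he]; rfl
    · intro f g hf hg
      rw [map_add, add_apply, hf, hg]
      simp [add_smul]
    · intro f g hf hg
      rw [map_mul, mul_apply_eq_comp, hg, map_smul, hf, smul_smul]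
      simp [mul_comm]
    · intro f hf
      have hc1 : Continuous fun g : C(spectrum ℝ a, ℝ) => cfcHom (R := ℝ) ha g e :=
        (ContinuousLinearMap.apply ℂ H e).continuous.comp (cfcHom_continuous (R := ℝ) ha)
      have hc2 : Continuous fun g : C(spectrum ℝ a, ℝ) => (g ⟨μ, hμ⟩ : ℂ) • e :=
        (Complex.continuous_ofReal.comp (continuous_eval_const _)).smul
          continuous_const
      exact (isClosed_eq hc1 hc2).mem_of_frequently_of_tendsto hf tendsto_id
  rw [cfc_apply f a ha hf, key]
  rfl

theorem rpow_apply_eigenvector {a : H →L[ℂ] H} (ha : 0 ≤ a) {e : H} {μ : ℝ}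
    (he : a e = (μ : ℂ) • e) {s : ℝ} (hs : 0 ≤ s) :
    (a ^ s) e = ((μ ^ s : ℝ) : ℂ) • e := by
  by_cases he0 : e = 0
  · simp [he0]
  rw [CFC.rpow_eq_cfc_real ha]
  exact cfc_apply_eigenvector ha.isSelfAdjoint he0 he (Real.continuous_rpow_const hs).continuousOn

/-- A weight is diagonal, with positive eigenvalues `l i` such that `∑ i, l i ^ p < ∞` for some
`p ∈ (0,1)`. -/
theorem Weight.exists_basis (ρ : Weight H) : ∃ (ι : Type u) (b : HilbertBasis ι ℂ H) (l : ι → ℝ),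
    (∀ i, 0 < l i) ∧ (∀ i, ρ.op (b i) = (l i : ℂ) • b i) ∧
    ∃ p : ℝ, 0 < p ∧ p < 1 ∧ Summable fun i => l i ^ p := by
  obtain ⟨ι, b, l, hl⟩ := exists_eigenbasis ρ.isCompact ρ.nonneg.isSelfAdjoint
  have hpos : ∀ i, 0 < l i := by
    intro i
    have h1 := ρ.2.1.2 (b i)
    have h2 : ρ.op (b i) ≠ 0 := fun h => b.orthonormal.ne_zero i (ρ.2.2.1 (by
      change ρ.op (b i) = ρ.op 0; rw [h, map_zero]))
    have h3 : inner ℂ (b i) (b i) = (1 : ℂ) := by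
      rw [inner_self_eq_norm_sq_to_K, b.orthonormal.1 i]; simp
    have h4 : 0 ≤ l i := by
      have h5 : ρ.1.reApplyInnerSelf (b i) = l i := by
        change RCLike.re (inner ℂ (ρ.op (b i)) (b i)) = l i
        rw [hl, inner_smul_left, h3]; simp
      rwa [h5] at h1
    refine lt_of_le_of_ne h4 fun h => h2 ?_
    rw [hl, ← h]; simp
  refine ⟨ι, b, l, hpos, hl, ?_⟩
  obtain ⟨p, hp0, hp1, w, c, hc⟩ := ρ.2.2.2
  refine ⟨p, hp0, hp1, ?_⟩
  -- The trace of `ρ^p` is the squared Hilbert–Schmidt norm of `ρ^{p/2}`. Its finiteness does not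
  -- depend on the basis, so it passes from the given basis `c` to the eigenbasis `b`.
  have hh : ∀ i, (ρ.op ^ (p / 2)) (b i) = ((l i ^ (p / 2) : ℝ) : ℂ) • b i := fun i =>
    rpow_apply_eigenvector ρ.nonneg (hl i) (by positivity)
  have hsym := inner_eq_conj_of_basis b hh
  have h2 : ρ.op ^ p = ρ.op ^ (p / 2) * ρ.op ^ (p / 2) := by
    refine clm_ext_basis b fun i => ?_
    rw [rpow_apply_eigenvector ρ.nonneg (hl i) hp0.le, mul_apply_eq_comp, hh, map_smul,
      hh, smul_smul, ← Complex.ofReal_mul, ← Real.rpow_add (hpos i), add_halves]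
  have h3 : Summable fun i => ‖(ρ.op ^ (p / 2)) (c i)‖ ^ 2 := by
    refine hc.congr fun i => ?_
    change (inner ℂ (c i) ((ρ.op ^ p) (c i))).re = _
    rw [h2, mul_apply_eq_comp, ← hsym, inner_self_eq_norm_sq_to_K (𝕜 := ℂ)]
    norm_cast
  refine (summable_sq_norm_of_adjoint c b hsym h3).congr fun i => ?_
  rw [hh, norm_smul, b.orthonormal.1 i, Complex.norm_real, mul_one, Real.norm_of_nonneg
    (Real.rpow_nonneg (hpos i).le _), ← Real.rpow_natCast, ← Real.rpow_mul (hpos i).le]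
  norm_num

theorem Weight.exists_of_diag {ι : Type*} (b : HilbertBasis ι ℂ H) {l : ι → ℝ} (hl : ∀ i, 0 < l i)
    {p : ℝ} (hp0 : 0 < p) (hp1 : p < 1) (hs : Summable fun i => l i ^ p) :
    ∃ ρ : Weight H, ∀ i, ρ.op (b i) = (l i : ℂ) • b i := by
  classical
  -- Each term of the convergent sum is at most the sum, so the eigenvalues are bounded and the
  -- diagonal operator exists.
  obtain ⟨C, hC⟩ : ∃ C, ∀ i, l i ≤ C := by
    refine ⟨(∑' i, l i ^ p) ^ (1 / p), fun i => ?_⟩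
    have h1 := hs.le_tsum i fun j _ => Real.rpow_nonneg (hl j).le p
    have h2 := Real.rpow_le_rpow (Real.rpow_nonneg (hl i).le _) h1 (by positivity : 0 ≤ 1 / p)
    rwa [← Real.rpow_mul (hl i).le, mul_one_div_cancel hp0.ne', Real.rpow_one] at h2
  have hC' : ∀ i, ‖(l i : ℂ)‖ ≤ C := fun i => by
    rw [Complex.norm_real, Real.norm_of_nonneg (hl i).le]; exact hC i
  let D := diag b fun i => (l i : ℂ)
  have hD : ∀ i, D (b i) = (l i : ℂ) • b i := diag_basis b hC'
  have hDi : ∀ i x, inner ℂ (b i) (D x) = l i * inner ℂ (b i) x := inner_diag b hC'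
  have hsym := inner_eq_conj_of_basis b hD
  have hpos : D.IsPositive := by
    refine ⟨hsym, fun x => ?_⟩
    change 0 ≤ RCLike.re (inner ℂ (D x) x)
    have h := Complex.hasSum_re (b.hasSum_inner_mul_inner (D x) x)
    refine h.nonneg fun i => ?_
    rw [hsym, hD, inner_smul_right, mul_assoc, ← inner_conj_symm, mul_comm (starRingEnd ℂ _),
      Complex.mul_conj, ← Complex.ofReal_mul, Complex.ofReal_re]
    exact mul_nonneg (hl i).le (Complex.normSq_nonneg _)
  have hnn : 0 ≤ D := (ContinuousLinearMap.nonneg_iff_isPositive _).2 hpos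
  refine ⟨⟨D, hpos, ?_, p, hp0, hp1, ?_⟩, hD⟩
  · rw [injective_iff_map_eq_zero]
    intro x hx
    refine basis_ext b fun i => ?_
    have := hDi i x
    rw [hx, inner_zero_right] at this
    rcases mul_eq_zero.1 this.symm with h | h
    · exact absurd (by exact_mod_cast h) (hl i).ne'
    · rw [h, inner_zero_right]
  -- `HasFiniteTrace` asks for a basis indexed by a subset of `H`, so `b` is reindexed by its range.
  · have hinj : Function.Injective b := b.orthonormal.linearIndependent.injective
    let c : HilbertBasis (Set.range b) ℂ H := HilbertBasis.mk (v := ((↑) : Set.range b → H))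
      b.orthonormal.toSubtypeRange (by rw [Subtype.range_coe, b.dense_span])
    refine ⟨Set.range b, c, ?_⟩
    rw [← (Equiv.ofInjective b hinj).summable_iff]
    refine hs.congr fun i => ?_
    have hci : c (Equiv.ofInjective b hinj i) = b i := by
      simp [c]
    simp only [Function.comp]
    rw [hci, rpow_apply_eigenvector hnn (hD i) hp0.le, inner_smul_right,
      inner_self_eq_norm_sq_to_K, b.orthonormal.1 i]
    simp

end

/-! ### From weak to norm holomorphy -/

section WeakHolomorphy

/-- The Schwarz lemma is used twice, first for `f` and then for its difference quotient. What
matters is that the constant depends only on `M` and `r`; `3` and `7` leave room above the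
oscillations `2M` and `6M / r`. -/
theorem norm_dslope_sub_le {f : ℂ → ℂ} {z : ℂ} {r M : ℝ} (hr : 0 < r) (hM : 0 < M)
    (hf : DifferentiableOn ℂ f (Metric.ball z r)) (hb : ∀ w ∈ Metric.ball z r, ‖f w‖ ≤ M) {w : ℂ}
    (hw : w ∈ Metric.ball z r) : ‖dslope f z w - dslope f z z‖ ≤ 7 * M / r ^ 2 * ‖w - z‖ := by
  have hz : z ∈ Metric.ball z r := Metric.mem_ball_self hr
  have h1 : ∀ w ∈ Metric.ball z r, ‖dslope f z w‖ ≤ 3 * M / r := fun w hw =>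
    Complex.norm_dslope_le_div_of_mapsTo_ball hf (fun v hv => by
      have := norm_sub_le (f v) (f z)
      simp only [Metric.mem_closedBall, dist_eq_norm]
      linarith [hb v hv, hb z hz]) hw
  have h2 : DifferentiableOn ℂ (dslope f z) (Metric.ball z r) :=
    (Complex.differentiableOn_dslope (Metric.ball_mem_nhds z hr)).2 hf
  have h3 := Complex.dist_le_div_mul_dist_of_mapsTo_ball (R₂ := 7 * M / r) h2 (fun v hv => by
      have := norm_sub_le (dslope f z v) (dslope f z z)
      have h4 : 3 * M / r + 3 * M / r < 7 * M / r := by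
        rw [← add_div]; gcongr; linarith
      simp only [Metric.mem_closedBall, dist_eq_norm]
      linarith [h1 v hv, h1 z hz]) hw
  rw [dist_eq_norm, dist_eq_norm] at h3
  rwa [div_div, ← sq] at h3

variable {H : Type u} [NormedAddCommGroup H] [InnerProductSpace ℂ H]

theorem opNorm_le_of_inner_le {s t : Set H} (hs : Dense s) (ht : Dense t) {A : H →L[ℂ] H} {C : ℝ}
    (hC : 0 ≤ C) (h : ∀ x ∈ s, ∀ y ∈ t, ‖inner ℂ x (A y)‖ ≤ C * ‖x‖ * ‖y‖) : ‖A‖ ≤ C := by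
  have h1 : ∀ x, ∀ y ∈ t, ‖inner ℂ x (A y)‖ ≤ C * ‖x‖ * ‖y‖ := fun x y hy =>
    hs.induction (fun x hx => h x hx y hy) (isClosed_le (by fun_prop) (by fun_prop)) x
  have h2 : ∀ x y, ‖inner ℂ x (A y)‖ ≤ C * ‖x‖ * ‖y‖ := fun x y =>
    ht.induction (fun y hy => h1 x y hy) (isClosed_le (by fun_prop) (by fun_prop)) y
  refine A.opNorm_le_bound hC fun y => ?_
  have h3 := h2 (A y) y
  rw [inner_self_eq_norm_sq_to_K] at h3
  by_cases h0 : ‖A y‖ = 0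
  · rw [h0]; positivity
  · have h4 : 0 < ‖A y‖ := lt_of_le_of_ne (norm_nonneg _) (Ne.symm h0)
    have h5 : ‖A y‖ ^ 2 ≤ C * ‖A y‖ * ‖y‖ := by simpa using h3
    nlinarith

/-- A bounded operator-valued function with holomorphic matrix elements is holomorphic in norm. -/
theorem differentiableOn_of_matrix [CompleteSpace H] {ι κ : Type*} (b : HilbertBasis ι ℂ H)
    (b' : HilbertBasis κ ℂ H) {U : ℂ → H →L[ℂ] H} {s : Set ℂ} (hs : IsOpen s) {K : ℝ}
    (hK : ∀ t ∈ s, ‖U t‖ ≤ K)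
    (h : ∀ i j, DifferentiableOn ℂ (fun t => inner ℂ (b i) (U t (b' j))) s) :
    DifferentiableOn ℂ U s := by
  have h1 : ∀ x ∈ Submodule.span ℂ (Set.range b), ∀ y ∈ Submodule.span ℂ (Set.range b'),
      DifferentiableOn ℂ (fun t => inner ℂ x (U t y)) s := by
    intro x hx y hy
    induction hx using Submodule.span_induction with
    | mem x hx =>
      obtain ⟨i, rfl⟩ := hx
      induction hy using Submodule.span_induction with
      | mem y hy => obtain ⟨j, rfl⟩ := hy; exact h i j
      | zero => simp
      | add y y' _ _ h1 h2 => simpa only [map_add, inner_add_right] using h1.fun_add h2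
      | smul a y _ h1 => simpa only [map_smul, inner_smul_right] using h1.const_mul a
    | zero => simp
    | add x x' _ _ h1 h2 => simpa only [inner_add_left] using h1.fun_add h2
    | smul a x _ h1 => simpa only [inner_smul_left] using h1.const_mul _
  intro z hz
  obtain ⟨r, hr, hrs⟩ := Metric.isOpen_iff.1 hs z hz
  set K' := max K 1
  have hK' : 0 < K' := lt_of_lt_of_le one_pos (le_max_right _ _)
  set c := 7 * K' / r ^ 2
  have hc : 0 < c := by positivity
  -- The scalar estimate is uniform over the matrix elements, so it bounds the operator norm, and
  -- the difference quotients at `z` form a Cauchy filter in norm.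
  have key : ∀ w ∈ Metric.ball z r, ∀ w' ∈ Metric.ball z r, w ≠ z → w' ≠ z →
      ‖slope U z w - slope U z w'‖ ≤ c * (‖w - z‖ + ‖w' - z‖) := by
    intro w hw w' hw' hwz hwz'
    refine opNorm_le_of_inner_le (dense_span_basis b) (dense_span_basis b') (by positivity) ?_
    intro x hx y hy
    by_cases hx0 : x = 0
    · simp [hx0]
    by_cases hy0 : y = 0
    · simp [hy0]
    have hM : 0 < K' * ‖x‖ * ‖y‖ :=
      mul_pos (mul_pos hK' (norm_pos_iff.2 hx0)) (norm_pos_iff.2 hy0)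
    have hb : ∀ w ∈ Metric.ball z r, ‖inner ℂ x (U w y)‖ ≤ K' * ‖x‖ * ‖y‖ := by
      intro w hw
      refine (norm_inner_le_norm _ _).trans ?_
      have h2 := ((U w).le_opNorm y).trans (mul_le_mul_of_nonneg_right
        ((hK w (hrs hw)).trans (le_max_left K 1)) (norm_nonneg y))
      calc ‖x‖ * ‖U w y‖ ≤ ‖x‖ * (K' * ‖y‖) := by gcongr
        _ = _ := by ring
    have h2 := fun w hw => norm_dslope_sub_le (w := w) hr hM ((h1 x hx y hy).mono hrs) hb hw
    have h3 : ∀ w, w ≠ z → inner ℂ x (slope U z w y) =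
        dslope (fun t => inner ℂ x (U t y)) z w := by
      intro w hw
      rw [dslope_of_ne _ hw, slope_def_module, slope_def_module]
      simp
    rw [sub_apply, inner_sub_right, h3 w hwz, h3 w' hwz']
    have h4 := norm_sub_le (dslope (fun t => inner ℂ x (U t y)) z w -
      dslope (fun t => inner ℂ x (U t y)) z z) (dslope (fun t => inner ℂ x (U t y)) z w' -
      dslope (fun t => inner ℂ x (U t y)) z z)
    rw [sub_sub_sub_cancel_right] at h4
    refine h4.trans ((add_le_add (h2 w hw) (h2 w' hw')).trans (le_of_eq ?_))
    simp only [c]; ring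
  have hcau : Cauchy (map (slope U z) (𝓝[≠] z)) := by
    rw [Metric.cauchy_iff]
    refine ⟨inferInstance, fun ε hε => ?_⟩
    set δ := min r (ε / (2 * c))
    have hδ : 0 < δ := lt_min hr (by positivity)
    refine ⟨slope U z '' (Metric.ball z δ ∩ {z}ᶜ), image_mem_map
      (inter_mem (mem_nhdsWithin_of_mem_nhds (Metric.ball_mem_nhds z hδ)) self_mem_nhdsWithin), ?_⟩
    rintro _ ⟨w, ⟨hw, hwz⟩, rfl⟩ _ ⟨w', ⟨hw', hwz'⟩, rfl⟩
    have hsub : Metric.ball z δ ⊆ Metric.ball z r := Metric.ball_subset_ball (min_le_left _ _)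
    rw [dist_eq_norm]
    refine (key w (hsub hw) w' (hsub hw') hwz hwz').trans_lt ?_
    rw [Metric.mem_ball, dist_eq_norm] at hw hw'
    have h5 : δ ≤ ε / (2 * c) := min_le_right _ _
    rw [le_div_iff₀ (by positivity)] at h5
    nlinarith
  obtain ⟨D, hD⟩ := cauchy_map_iff_exists_tendsto.1 hcau
  exact (hasDerivAt_iff_tendsto_slope.2 hD).differentiableAt.differentiableWithinAt

end WeakHolomorphy

/-! ### Complex powers of a weight -/

section

variable {H : Type u} [NormedAddCommGroup H] [InnerProductSpace ℂ H] [CompleteSpace H]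
  {ι κ : Type*}

/-- `b` is an orthonormal basis of eigenvectors of the weight `ρ`, with eigenvalues `l`. -/
structure Weight.IsBasis (ρ : Weight H) (b : HilbertBasis ι ℂ H) (l : ι → ℝ) : Prop where
  pos : ∀ i, 0 < l i
  eig : ∀ i, ρ.op (b i) = (l i : ℂ) • b i

theorem Weight.exists_isBasis (ρ : Weight H) :
    ∃ (ι : Type u) (b : HilbertBasis ι ℂ H) (l : ι → ℝ), ρ.IsBasis b l := by
  obtain ⟨ι, b, l, h1, h2, -⟩ := ρ.exists_basis
  exact ⟨ι, b, l, h1, h2⟩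

namespace Weight.IsBasis

variable {ρ : Weight H} {b : HilbertBasis ι ℂ H} {l : ι → ℝ}

theorem le_norm (h : ρ.IsBasis b l) (i : ι) : l i ≤ ‖ρ.op‖ := by
  have h1 := ρ.op.le_opNorm (b i)
  rwa [h.eig, norm_smul, b.orthonormal.1 i, Complex.norm_real, Real.norm_of_nonneg (h.pos i).le,
    mul_one, mul_one] at h1

theorem isEigenbasis (h : ρ.IsBasis b l) : IsEigenbasis (bdd ρ.op) b l := isEigenbasis_bdd h.eig

theorem mem_cpow (h : ρ.IsBasis b l) {t : ℂ} {x y : H} :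
    (x, y) ∈ (cpow ρ.op t).graph ↔ ∀ i, inner ℂ (b i) y = (l i : ℂ) ^ t * inner ℂ (b i) x :=
  h.isEigenbasis.mem_spectralFun _

theorem norm_cpow (h : ρ.IsBasis b l) (t : ℂ) (i : ι) : ‖(l i : ℂ) ^ t‖ = l i ^ t.re :=
  Complex.norm_cpow_eq_rpow_re_of_pos (h.pos i) t

theorem norm_cpow_le (h : ρ.IsBasis b l) {t : ℂ} (ht : 0 ≤ t.re) (i : ι) :
    ‖(l i : ℂ) ^ t‖ ≤ ‖ρ.op‖ ^ t.re := by
  rw [h.norm_cpow]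
  exact Real.rpow_le_rpow (h.pos i).le (h.le_norm i) ht

theorem cpow_ne_zero (h : ρ.IsBasis b l) (t : ℂ) (i : ι) : (l i : ℂ) ^ t ≠ 0 := by
  rw [← norm_ne_zero_iff, h.norm_cpow]
  exact (Real.rpow_pos_of_pos (h.pos i) _).ne'

theorem cpow_neg_mul (h : ρ.IsBasis b l) (t : ℂ) (i : ι) :
    (l i : ℂ) ^ (-t) * (l i : ℂ) ^ t = 1 := by
  rw [Complex.cpow_neg, inv_mul_cancel₀ (h.cpow_ne_zero t i)]

end Weight.IsBasis

/-- As graphs, `ρ^{-t}` and `ρ^t` are transposes of each other. This removes the unbounded power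
from the products below. -/
theorem mem_cpow_neg (ρ : Weight H) {t : ℂ} {x y : H} :
    (x, y) ∈ (cpow ρ.op (-t)).graph ↔ (y, x) ∈ (cpow ρ.op t).graph := by
  obtain ⟨ι, b, l, h⟩ := ρ.exists_isBasis
  rw [h.mem_cpow, h.mem_cpow]
  refine forall_congr' fun i => ?_
  have h1 := h.cpow_neg_mul t i
  constructor
  · intro h2; rw [h2, ← mul_assoc, mul_comm (_ ^ t), h1, one_mul]
  · intro h2; rw [h2, ← mul_assoc, h1, one_mul]

open Classical in
/-- The complex power `ρ ^ t` as a bounded operator, for `0 ≤ t.re`. -/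
def Weight.pow (ρ : Weight H) (t : ℂ) : H →L[ℂ] H :=
  if h : ∃ P : H →L[ℂ] H, cpow ρ.op t = bdd P then h.choose else 0

theorem Weight.cpow_eq_bdd_pow (ρ : Weight H) {t : ℂ} (ht : 0 ≤ t.re) :
    cpow ρ.op t = bdd (ρ.pow t) := by
  have h : ∃ P : H →L[ℂ] H, cpow ρ.op t = bdd P := by
    obtain ⟨ι, b, l, h⟩ := ρ.exists_isBasis
    exact ⟨diag b fun i => (l i : ℂ) ^ t,
      h.isEigenbasis.spectralFun_eq_bdd _ fun i => inner_diag b (h.norm_cpow_le ht) i⟩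
  rw [Weight.pow, dif_pos h]
  exact h.choose_spec

theorem Weight.mem_graph_cpow (ρ : Weight H) {t : ℂ} (ht : 0 ≤ t.re) {x y : H} :
    (x, y) ∈ (cpow ρ.op t).graph ↔ ρ.pow t x = y := by
  rw [ρ.cpow_eq_bdd_pow ht, mem_graph_bdd]

namespace Weight.IsBasis

variable {ρ : Weight H} {b : HilbertBasis ι ℂ H} {l : ι → ℝ}

theorem inner_pow (h : ρ.IsBasis b l) {t : ℂ} (ht : 0 ≤ t.re) (i : ι) (x : H) :
    inner ℂ (b i) (ρ.pow t x) = (l i : ℂ) ^ t * inner ℂ (b i) x :=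
  h.mem_cpow.1 ((ρ.mem_graph_cpow ht).2 rfl) i

theorem pow_basis (h : ρ.IsBasis b l) {t : ℂ} (ht : 0 ≤ t.re) (i : ι) :
    ρ.pow t (b i) = (l i : ℂ) ^ t • b i := by
  classical
  refine basis_ext b fun j => ?_
  rw [h.inner_pow ht, inner_smul_right, orthonormal_iff_ite.1 b.orthonormal j i]
  split_ifs with hij
  · rw [hij]
  · simp

end Weight.IsBasis

namespace Weight

variable (ρ σ : Weight H)

theorem norm_pow_le {t : ℂ} (ht : 0 ≤ t.re) : ‖ρ.pow t‖ ≤ ‖ρ.op‖ ^ t.re := by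
  obtain ⟨ι, b, l, h⟩ := ρ.exists_isBasis
  refine ContinuousLinearMap.opNorm_le_bound _ (Real.rpow_nonneg (norm_nonneg _) _) fun x =>
    norm_le_of_coord b (Real.rpow_nonneg (norm_nonneg _) _) fun i => ?_
  rw [h.inner_pow ht, norm_mul]
  exact mul_le_mul_of_nonneg_right (h.norm_cpow_le ht i) (norm_nonneg _)

theorem pow_denseRange {t : ℂ} (ht : 0 ≤ t.re) : DenseRange (ρ.pow t) := by
  obtain ⟨ι, b, l, h⟩ := ρ.exists_isBasis
  refine (dense_span_basis b).mono ?_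
  have : Submodule.span ℂ (Set.range b) ≤ LinearMap.range (ρ.pow t : H →ₗ[ℂ] H) := by
    rw [Submodule.span_le]
    rintro _ ⟨i, rfl⟩
    refine ⟨((l i : ℂ) ^ t)⁻¹ • b i, ?_⟩
    change ρ.pow t _ = _
    rw [map_smul, h.pow_basis ht, smul_smul, inv_mul_cancel₀ (h.cpow_ne_zero t i), one_smul]
  rintro x hx
  obtain ⟨y, hy⟩ := this hx
  exact ⟨y, hy⟩

theorem norm_pow_apply {t : ℂ} (ht : 0 ≤ t.re) (x : H) : ‖ρ.pow t x‖ = ‖ρ.pow t.re x‖ := by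
  obtain ⟨ι, b, l, h⟩ := ρ.exists_isBasis
  have ht' : 0 ≤ (t.re : ℂ).re := ht
  have key : ∀ i, ‖inner ℂ (b i) (ρ.pow t x)‖ = ‖inner ℂ (b i) (ρ.pow t.re x)‖ := fun i => by
    rw [h.inner_pow ht, h.inner_pow ht', norm_mul, norm_mul, h.norm_cpow, h.norm_cpow,
      Complex.ofReal_re]
  refine le_antisymm ?_ ?_
  · simpa using norm_le_of_coord b zero_le_one fun i => (key i).le.trans (one_mul _).ge
  · simpa using norm_le_of_coord b zero_le_one fun i => (key i).ge.trans (one_mul _).ge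

theorem inner_pow_left {t : ℂ} (ht : 0 ≤ t.re) (x y : H) :
    inner ℂ (ρ.pow t x) y = inner ℂ x (ρ.pow (starRingEnd ℂ t) y) := by
  obtain ⟨ι, b, l, h⟩ := ρ.exists_isBasis
  have ht' : 0 ≤ (starRingEnd ℂ t).re := ht
  rw [← b.tsum_inner_mul_inner, ← b.tsum_inner_mul_inner]
  refine tsum_congr fun i => ?_
  have h1 : starRingEnd ℂ ((l i : ℂ) ^ t) = (l i : ℂ) ^ (starRingEnd ℂ t) := by
    rw [Complex.cpow_conj _ _ (by
      rw [Complex.arg_ofReal_of_nonneg (h.pos i).le]; exact Real.pi_pos.ne), Complex.conj_ofReal]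
  rw [h.inner_pow ht', ← inner_conj_symm, h.inner_pow ht, map_mul, inner_conj_symm, h1]
  ring

theorem pow_zero_eq : ρ.pow 0 = 1 := by
  obtain ⟨ι, b, l, h⟩ := ρ.exists_isBasis
  exact clm_ext_basis b fun i => by rw [h.pow_basis le_rfl]; simp

theorem pow_add {s t : ℂ} (hs : 0 ≤ s.re) (ht : 0 ≤ t.re) :
    ρ.pow (s + t) = ρ.pow s * ρ.pow t := by
  obtain ⟨ι, b, l, h⟩ := ρ.exists_isBasis
  refine clm_ext_basis b fun i => ?_
  rw [mul_apply_eq_comp, h.pow_basis ht, map_smul, h.pow_basis hs, h.pow_basis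
    (by rw [Complex.add_re]; exact add_nonneg hs ht), smul_smul, Complex.cpow_add _ _
    (by exact_mod_cast (h.pos i).ne'), mul_comm]

theorem rpow_eq_pow {s : ℝ} (hs : 0 ≤ s) : ρ.op ^ s = ρ.pow s := by
  obtain ⟨ι, b, l, h⟩ := ρ.exists_isBasis
  refine clm_ext_basis b fun i => ?_
  rw [h.pow_basis hs, rpow_apply_eigenvector ρ.nonneg (h.eig i) hs, Complex.ofReal_cpow (h.pos i).le]

theorem sq_norm_pow {s : ℝ} (hs : 0 ≤ s) (x : H) :
    ((‖ρ.pow s x‖ ^ 2 : ℝ) : ℂ) = inner ℂ x ((ρ.op ^ (2 * s)) x) := by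
  have hs' : 0 ≤ (s : ℂ).re := hs
  rw [ρ.rpow_eq_pow (by positivity), two_mul, Complex.ofReal_add, ρ.pow_add hs' hs',
    mul_apply_eq_comp]
  have := ρ.inner_pow_left hs' x (ρ.pow s x)
  rw [Complex.conj_ofReal] at this
  rw [← this, inner_self_eq_norm_sq_to_K]
  norm_cast

theorem sq_norm_pow_half (x : H) :
    ((‖ρ.pow (1 / 2 : ℝ) x‖ ^ 2 : ℝ) : ℂ) = inner ℂ x (ρ.op x) := by
  have hs : (0 : ℝ) ≤ 1 / 2 := by norm_num
  have h1 : (2 : ℝ) * (1 / 2) = 1 := by norm_num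
  rw [ρ.sq_norm_pow hs, h1, CFC.rpow_one _ ρ.nonneg]

variable {ρ σ}

/-- Substituting `σ^t x` for the vector in the domain of `σ^{-t}` leaves an identity between bounded
operators. -/
theorem isBoundedExtension_iff {t : ℂ} (ht : 0 ≤ t.re) {X Y : H →L[ℂ] H} :
    IsBoundedExtension (cpow ρ.op t) X (cpow σ.op (-t)) Y ↔
      ∀ x, Y (σ.pow t x) = ρ.pow t (X x) := by
  rw [Araki.isBoundedExtension_iff]
  constructor
  · intro h x
    have := h _ _ ((mem_cpow_neg σ).2 ((σ.mem_graph_cpow ht).2 rfl : (x, σ.pow t x) ∈ _))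
    exact ((ρ.mem_graph_cpow ht).1 this).symm
  · intro h x y hxy
    rw [mem_cpow_neg, σ.mem_graph_cpow ht] at hxy
    rw [ρ.mem_graph_cpow ht, ← hxy, h]

theorem isBoundedExtension_neg_iff {t : ℂ} (ht : 0 ≤ t.re) {X Y : H →L[ℂ] H} :
    IsBoundedExtension (cpow ρ.op (-t)) X (cpow σ.op t) Y ↔
      ∀ x, ρ.pow t (Y x) = X (σ.pow t x) := by
  rw [Araki.isBoundedExtension_iff]
  constructor
  · intro h x
    have := h _ _ ((σ.mem_graph_cpow ht).2 rfl : (x, σ.pow t x) ∈ _)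
    rwa [mem_cpow_neg, ρ.mem_graph_cpow ht] at this
  · intro h x y hxy
    rw [σ.mem_graph_cpow ht] at hxy
    rw [mem_cpow_neg, ρ.mem_graph_cpow ht, ← hxy, h]

end Weight

/-! ### Nearby weights and the Connes cocycle -/

section Nearby

variable {ρ σ τ : Weight H}

omit [CompleteSpace H] in
theorem real_smul_apply (c : ℝ) (A : H →L[ℂ] H) (x : H) : (c • A) x = (c : ℂ) • A x :=
  RCLike.real_smul_eq_coe_smul (K := ℂ) c (A x)

omit [CompleteSpace H] in
theorem inner_real_smul_apply (c : ℝ) (A : H →L[ℂ] H) (x : H) :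
    inner ℂ x ((c • A) x) = c * inner ℂ x (A x) := by
  rw [real_smul_apply, inner_smul_right]

theorem inv_smul_op_le_iff {A B : H →L[ℂ] H} {c : ℝ} (hc : 0 < c) : c⁻¹ • A ≤ B ↔ A ≤ c • B := by
  constructor
  · intro h
    have := smul_le_smul_of_nonneg_left h hc.le
    rwa [smul_inv_smul₀ hc.ne'] at this
  · intro h
    have := smul_le_smul_of_nonneg_left h (inv_nonneg.2 hc.le)
    rwa [inv_smul_smul₀ hc.ne'] at this

theorem Nearby.symm (h : Nearby ρ σ) : Nearby σ ρ := by
  obtain ⟨C, hC, h1, h2⟩ := h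
  have hC0 : 0 < C := by linarith
  refine ⟨C, hC, ?_, ?_⟩
  · rwa [inv_smul_op_le_iff hC0]
  · rwa [inv_smul_op_le_iff hC0] at h1

theorem Nearby.trans (h : Nearby ρ σ) (h' : Nearby σ τ) : Nearby ρ τ := by
  obtain ⟨C, hC, h1, h2⟩ := h
  obtain ⟨D, hD, h3, h4⟩ := h'
  have hC0 : 0 < C := by linarith
  have hD0 : 0 < D := by linarith
  refine ⟨D * C, by nlinarith, ?_, ?_⟩
  · rw [mul_inv, mul_smul]
    exact (smul_le_smul_of_nonneg_left h1 (inv_nonneg.2 hD0.le)).trans h3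
  · rw [mul_smul]
    exact h4.trans (smul_le_smul_of_nonneg_left h2 hD0.le)

omit [CompleteSpace H] in
theorem inner_le_of_le {A B : H →L[ℂ] H} (h : A ≤ B) (x : H) :
    (inner ℂ x (A x)).re ≤ (inner ℂ x (B x)).re := by
  rw [ContinuousLinearMap.le_def] at h
  have h1 := (Complex.le_def.1 (h.inner_nonneg_right x)).1
  rw [sub_apply, inner_sub_right, Complex.sub_re, Complex.zero_re] at h1
  linarith

theorem le_of_inner_le {A B : H →L[ℂ] H} (hA : IsSelfAdjoint A) (hB : IsSelfAdjoint B)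
    (h : ∀ x, (inner ℂ x (A x)).re ≤ (inner ℂ x (B x)).re) : A ≤ B := by
  rw [ContinuousLinearMap.le_def]
  refine ⟨(hB.sub hA).isSymmetric, fun x => ?_⟩
  change 0 ≤ (inner ℂ ((B - A) x) x).re
  rw [← inner_conj_symm, Complex.conj_re, sub_apply, inner_sub_right, Complex.sub_re]
  linarith [h x]

theorem smul_rpow_weight {C : ℝ} (hC : 0 ≤ C) (ρ : Weight H) {s : ℝ} (hs : 0 ≤ s) :
    (C • ρ.op) ^ s = C ^ s • ρ.op ^ s := by
  obtain ⟨ι, b, l, hb⟩ := ρ.exists_isBasis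
  have hnn : 0 ≤ C • ρ.op := smul_nonneg hC ρ.nonneg
  refine clm_ext_basis b fun i => ?_
  have he : (C • ρ.op) (b i) = ((C * l i : ℝ) : ℂ) • b i := by
    rw [real_smul_apply, hb.eig, smul_smul, Complex.ofReal_mul]
  rw [rpow_apply_eigenvector hnn he hs, real_smul_apply,
    rpow_apply_eigenvector ρ.nonneg (hb.eig i) hs, Real.mul_rpow hC (hb.pos i).le, smul_smul,
    Complex.ofReal_mul]

/-- Operator monotonicity of the powers with exponent in `[0,1]`. -/
theorem norm_pow_le_of_le {C : ℝ} (hC : 1 ≤ C) (h : σ.op ≤ C • ρ.op) {s : ℝ} (hs : 0 ≤ s)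
    (hs' : s ≤ 1 / 2) (x : H) : ‖σ.pow s x‖ ≤ C * ‖ρ.pow s x‖ := by
  have hC0 : 0 ≤ C := by linarith
  -- The Löwner–Heinz inequality needs `2s ≤ 1`; this is where the radius `1/2` of the disc comes
  -- from.
  have h1 : σ.op ^ (2 * s) ≤ (C • ρ.op) ^ (2 * s) :=
    CFC.rpow_le_rpow ⟨by positivity, by linarith⟩ h
  rw [smul_rpow_weight hC0 ρ (by positivity)] at h1
  have h3 := inner_le_of_le h1 x
  rw [inner_real_smul_apply, ← σ.sq_norm_pow hs, ← ρ.sq_norm_pow hs, ← Complex.ofReal_mul,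
    Complex.ofReal_re, Complex.ofReal_re] at h3
  -- The constant is weakened to one independent of `s`, since the cocycle has to be bounded
  -- uniformly on the disc.
  have h5 : C ^ (2 * s) ≤ C := by
    conv_rhs => rw [← Real.rpow_one C]
    exact Real.rpow_le_rpow_of_exponent_le hC (by linarith)
  have h6 : ‖σ.pow s x‖ ^ 2 ≤ (C * ‖ρ.pow s x‖) ^ 2 := by
    refine h3.trans ?_
    rw [mul_pow]
    exact mul_le_mul_of_nonneg_right (by nlinarith) (sq_nonneg _)
  exact (sq_le_sq₀ (norm_nonneg _) (by positivity)).1 h6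

/-- Squaring turns the norms of `ρ^{1/2} x` into the quadratic form of `ρ`. The constant `K ^ 2 + 2`
exceeds `1` whatever `K` is. -/
theorem nearby_of_norm_pow_half_le {K : ℝ} (h1 : ∀ x, ‖σ.pow (1 / 2 : ℝ) x‖ ≤ K * ‖ρ.pow (1 / 2 : ℝ) x‖)
    (h2 : ∀ x, ‖ρ.pow (1 / 2 : ℝ) x‖ ≤ K * ‖σ.pow (1 / 2 : ℝ) x‖) : Nearby ρ σ := by
  have key : ∀ {ρ σ : Weight H}, (∀ x, ‖σ.pow (1 / 2 : ℝ) x‖ ≤ K * ‖ρ.pow (1 / 2 : ℝ) x‖) →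
      σ.op ≤ (K ^ 2 + 2) • ρ.op := by
    intro ρ σ h
    have hnn : 0 ≤ (K ^ 2 + 2) • ρ.op := smul_nonneg (by positivity) ρ.nonneg
    refine le_of_inner_le σ.nonneg.isSelfAdjoint hnn.isSelfAdjoint fun x => ?_
    have h3 := σ.sq_norm_pow_half x
    have h4 := ρ.sq_norm_pow_half x
    rw [inner_real_smul_apply, ← h3, ← h4, ← Complex.ofReal_mul, Complex.ofReal_re, Complex.ofReal_re]
    have h6 := pow_le_pow_left₀ (norm_nonneg _) (h x) 2
    nlinarith [sq_nonneg ‖ρ.pow (1 / 2 : ℝ) x‖]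
  have hp : 0 < K ^ 2 + 2 := by positivity
  refine ⟨K ^ 2 + 2, by nlinarith [sq_nonneg K], ?_, key h1⟩
  rw [inv_smul_op_le_iff hp]
  exact key h2

/-- Only the real part of `t` affects the norm of `ρ^t x`, so the estimate for real powers lets the
map `ρ^t x ↦ σ^t x` extend from the dense range of `ρ^t`. -/
theorem exists_cocycle_of_nonneg {C : ℝ} (hC : 1 ≤ C) (h : σ.op ≤ C • ρ.op) {t : ℂ}
    (ht : 0 ≤ t.re) (ht' : t.re ≤ 1 / 2) : ∃ U : H →L[ℂ] H, ‖U‖ ≤ C ∧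
      ∀ x, U (ρ.pow t x) = σ.pow t x := by
  have hn : ∀ x, ‖(σ.pow t : H →ₗ[ℂ] H) x‖ ≤ C * ‖(ρ.pow t : H →ₗ[ℂ] H) x‖ := fun x => by
    change ‖σ.pow t x‖ ≤ C * ‖ρ.pow t x‖
    rw [σ.norm_pow_apply ht, ρ.norm_pow_apply ht]
    exact norm_pow_le_of_le hC h ht ht' x
  have hd : DenseRange (ρ.pow t : H →ₗ[ℂ] H) := ρ.pow_denseRange ht
  exact ⟨_, LinearMap.opNorm_extendOfNorm_le hd (by linarith) hn,
    fun x => LinearMap.extendOfNorm_eq hd ⟨C, hn⟩ x⟩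

theorem exists_cocycle (h : Nearby ρ σ) : ∃ K : ℝ, ∀ t ∈ disc, ∃ U : H →L[ℂ] H, ‖U‖ ≤ K ∧
    IsBoundedExtension (cpow ρ.op t) 1 (cpow σ.op (-t)) U := by
  obtain ⟨C, hC, h1, h2⟩ := h
  rw [inv_smul_op_le_iff (by linarith)] at h1
  refine ⟨C, fun t ht => ?_⟩
  have ht2 : |t.re| ≤ 1 / 2 := by
    have := Complex.abs_re_le_norm t
    simp only [disc, Metric.mem_ball, dist_zero_right] at ht
    linarith
  rw [abs_le] at ht2
  rcases le_total 0 t.re with h0 | h0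
  · obtain ⟨U, hU, hU'⟩ := exists_cocycle_of_nonneg hC.le h1 h0 ht2.2
    exact ⟨U, hU, (Weight.isBoundedExtension_iff h0).2 fun x => by rw [hU']; simp⟩
  · obtain ⟨s, rfl⟩ : ∃ s, t = -s := ⟨-t, by simp⟩
    have hs : 0 ≤ s.re := by simpa using h0
    have hs2 : s.re ≤ 1 / 2 := by simp only [Complex.neg_re] at ht2; linarith
    have hs' : 0 ≤ (starRingEnd ℂ s).re := hs
    -- For `t = -s` the operator sought is `ρ^{-s} σ^s`. It is the adjoint of the one that sends
    -- `ρ^{s̄} x` to `σ^{s̄} x`, which uses the other of the two order inequalities.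
    obtain ⟨U, hU, hU'⟩ := exists_cocycle_of_nonneg (t := starRingEnd ℂ s) hC.le h2 hs' hs2
    refine ⟨ContinuousLinearMap.adjoint U, by rwa [LinearIsometryEquiv.norm_map], ?_⟩
    rw [neg_neg, Weight.isBoundedExtension_neg_iff hs]
    intro x
    refine ext_inner_left ℂ fun y => ?_
    have e1 := ρ.inner_pow_left hs' y (ContinuousLinearMap.adjoint U x)
    have e2 := σ.inner_pow_left hs' y x
    rw [Complex.conj_conj] at e1 e2
    rw [← e1, ContinuousLinearMap.adjoint_inner_right, hU', e2]
    rfl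

theorem cocycle_spec (h : Nearby ρ σ) {t : ℂ} (ht : t ∈ disc) :
    IsBoundedExtension (cpow ρ.op t) 1 (cpow σ.op (-t)) (cocycle ρ σ t) := by
  obtain ⟨K, hK⟩ := exists_cocycle h
  obtain ⟨U, -, hU⟩ := hK t ht
  rw [cocycle, boundedExtension_eq σ hU]
  exact hU

theorem cocycle_bounded (h : Nearby ρ σ) : ∃ K : ℝ, ∀ t ∈ disc, ‖cocycle ρ σ t‖ ≤ K := by
  obtain ⟨K, hK⟩ := exists_cocycle h
  refine ⟨K, fun t ht => ?_⟩
  obtain ⟨U, hU1, hU⟩ := hK t ht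
  rwa [cocycle, boundedExtension_eq σ hU]

theorem isOpen_disc : IsOpen disc := Metric.isOpen_ball

theorem cocycle_differentiableOn (h : Nearby ρ σ) : DifferentiableOn ℂ (cocycle ρ σ) disc := by
  obtain ⟨K, hK⟩ := cocycle_bounded h
  obtain ⟨ι, b, l, hb⟩ := ρ.exists_isBasis
  obtain ⟨κ, b', l', hb'⟩ := σ.exists_isBasis
  refine differentiableOn_of_matrix b b' isOpen_disc hK fun i j => ?_
  -- Between eigenvectors of `ρ` and of `σ` the cocycle is an explicit entire function of `t`.
  have key : ∀ t ∈ disc, inner ℂ (b i) (cocycle ρ σ t (b' j)) =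
      (l i : ℂ) ^ t * ((l' j : ℂ) ^ (-t) * inner ℂ (b i) (b' j)) := by
    intro t ht
    have h1 := isBoundedExtension_iff.1 (cocycle_spec h ht) (b' j) ((l' j : ℂ) ^ (-t) • b' j)
      (σ.eigen_mem _ _ _ (hb'.eig j))
    have h2 := hb.mem_cpow.1 h1 i
    rw [h2, map_smul, inner_smul_right]
    rfl
  refine DifferentiableOn.congr ?_ key
  have hl : (l i : ℂ) ≠ 0 := by exact_mod_cast (hb.pos i).ne'
  have hl' : (l' j : ℂ) ≠ 0 := by exact_mod_cast (hb'.pos j).ne'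
  have e1 : Differentiable ℂ fun t : ℂ => (l i : ℂ) ^ t :=
    differentiable_id.const_cpow (Or.inl hl)
  have e2 : Differentiable ℂ fun t : ℂ => (l' j : ℂ) ^ (-t) :=
    differentiable_id.neg.const_cpow (Or.inl hl')
  exact (e1.mul (e2.mul_const _)).differentiableOn

/-- The inner factors `ρ^{-t}` and `ρ^t` cancel. This yields the inverse of the cocycle, and the
conjugation formula by inserting `σ^{-t} σ^t` twice. -/
theorem IsBoundedExtension.comp {A B : H →ₗ.[ℂ] H} {t : ℂ} {X X' Y Y' : H →L[ℂ] H}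
    (h : IsBoundedExtension A X (cpow ρ.op (-t)) Y)
    (h' : IsBoundedExtension (cpow ρ.op t) X' B Y') : IsBoundedExtension A (X * X') B (Y * Y') := by
  rw [isBoundedExtension_iff] at *
  intro x y hxy
  exact h _ _ ((mem_cpow_neg ρ).2 (h' x y hxy))

theorem isBoundedExtension_one (ρ : Weight H) (t : ℂ) :
    IsBoundedExtension (cpow ρ.op t) 1 (cpow ρ.op (-t)) 1 := by
  rw [isBoundedExtension_iff]
  intro x y hxy
  exact (mem_cpow_neg ρ).1 hxy

theorem cocycle_mul_cocycle (h : Nearby ρ σ) {t : ℂ} (ht : t ∈ disc) :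
    cocycle ρ σ t * cocycle σ ρ t = 1 := by
  have h1 := (cocycle_spec h ht).comp (cocycle_spec h.symm ht)
  rw [mul_one] at h1
  exact ρ.ext_unique h1 (isBoundedExtension_one ρ t)

theorem isBoundedExtension_of_nearby (h : Nearby ρ σ) {t : ℂ} (ht : t ∈ disc) {X Y : H →L[ℂ] H}
    (hX : IsBoundedExtension (cpow σ.op t) X (cpow σ.op (-t)) Y) :
    IsBoundedExtension (cpow ρ.op t) X (cpow ρ.op (-t)) (cocycle ρ σ t * Y * cocycle σ ρ t) := by
  have h1 := ((cocycle_spec h ht).comp hX).comp (cocycle_spec h.symm ht)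
  rwa [mul_one, one_mul] at h1

theorem conj_eq_of_nearby (h : Nearby ρ σ) {t : ℂ} (ht : t ∈ disc) {X : H →L[ℂ] H}
    (hX : X ∈ arakiSubmodule σ) :
    conj ρ t X = cocycle ρ σ t * conj σ t X * cocycle σ ρ t :=
  boundedExtension_eq ρ (isBoundedExtension_of_nearby h ht (IsArakiAnalytic.isBoundedExtension hX ht))

theorem arakiSubmodule_le_of_nearby (h : Nearby ρ σ) : arakiSubmodule σ ≤ arakiSubmodule ρ := by
  rintro X ⟨Y, hd, ⟨C, hC⟩, hY⟩
  obtain ⟨K, hK⟩ := cocycle_bounded h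
  obtain ⟨K', hK'⟩ := cocycle_bounded h.symm
  refine ⟨fun t => cocycle ρ σ t * Y t * cocycle σ ρ t,
    ((cocycle_differentiableOn h).mul hd).mul (cocycle_differentiableOn h.symm),
    ⟨K * C * K', fun t ht => ?_⟩, fun t ht => isBoundedExtension_of_nearby h ht (hY t ht)⟩
  have hK0 := (norm_nonneg _).trans (hK t ht)
  have hC0 := (norm_nonneg _).trans (hC t ht)
  refine (norm_mul_le _ _).trans (mul_le_mul ((norm_mul_le _ _).trans (mul_le_mul (hK t ht)
    (hC t ht) (norm_nonneg _) hK0)) (hK' t ht) (norm_nonneg _) (by positivity))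

theorem arakiSubmodule_eq_of_nearby (h : Nearby ρ σ) : arakiSubmodule ρ = arakiSubmodule σ :=
  le_antisymm (arakiSubmodule_le_of_nearby h.symm) (arakiSubmodule_le_of_nearby h)

theorem norm_conj_le_arakiNorm {X : H →L[ℂ] H} (hX : IsArakiAnalytic ρ X) {t : ℂ} (ht : t ∈ disc) :
    ‖conj ρ t X‖ ≤ arakiNorm ρ X :=
  le_ciSup hX.bddAbove ⟨t, ht⟩

theorem arakiNorm_le_of_nearby (h : Nearby ρ σ) : ∃ c : ℝ, 0 < c ∧ ∀ X ∈ arakiSubmodule σ,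
    arakiNorm ρ X ≤ c * arakiNorm σ X := by
  obtain ⟨K, hK⟩ := cocycle_bounded h
  obtain ⟨K', hK'⟩ := cocycle_bounded h.symm
  have hK0 := (norm_nonneg _).trans (hK 0 zero_mem_disc)
  have hK0' := (norm_nonneg _).trans (hK' 0 zero_mem_disc)
  refine ⟨K * K' + 1, by positivity, fun X hX => ?_⟩
  have : Nonempty disc := ⟨⟨0, zero_mem_disc⟩⟩
  have hn := fun t ht => norm_conj_le_arakiNorm (t := t) (show IsArakiAnalytic σ X from hX) ht
  have h0 : 0 ≤ arakiNorm σ X := (norm_nonneg _).trans (hn 0 zero_mem_disc)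
  refine ciSup_le fun t => ?_
  rw [conj_eq_of_nearby h t.2 hX]
  calc _ ≤ K * arakiNorm σ X * K' := (norm_mul_le _ _).trans (mul_le_mul ((norm_mul_le _ _).trans
        (mul_le_mul (hK t t.2) (hn t t.2) (norm_nonneg _) hK0)) (hK' t t.2) (norm_nonneg _)
        (by positivity))
    _ ≤ (K * K' + 1) * arakiNorm σ X := by nlinarith

end Nearby

end

/-! ### Dyson series for linear differential equations -/

section LinearODE

variable {𝔸 : Type*} [NormedRing 𝔸] [NormedAlgebra ℝ 𝔸] [CompleteSpace 𝔸]

/-- The terms of the Dyson series of the linear differential equation `Z' = A Z`, `Z 0 = 1`. -/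
def dyson (A : ℝ → 𝔸) : ℕ → ℝ → 𝔸
  | 0 => fun _ => 1
  | n + 1 => fun t => ∫ r in (0 : ℝ)..t, A r * dyson A n r

theorem hasDerivAt_dyson {A : ℝ → 𝔸} (hA : Continuous A) (n : ℕ) :
    (∀ t, HasDerivAt (dyson A (n + 1)) (A t * dyson A n t) t) := by
  induction n with
  | zero =>
    intro t
    have hc : Continuous fun r => A r * dyson A 0 r := hA.mul continuous_const
    exact (hc.integral_hasStrictDerivAt 0 t).hasDerivAt
  | succ n ih =>
    intro t
    have hc : Continuous fun r => A r * dyson A (n + 1) r :=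
      hA.mul (continuous_iff_continuousAt.2 fun t => (ih t).continuousAt)
    exact (hc.integral_hasStrictDerivAt 0 t).hasDerivAt

omit [CompleteSpace 𝔸] in
theorem norm_dyson_le {A : ℝ → 𝔸} {M : ℝ} (hM : ∀ t, ‖A t‖ ≤ M)
    (n : ℕ) (t : ℝ) : ‖dyson A n t‖ ≤ ‖(1 : 𝔸)‖ * (M * |t|) ^ n / n.factorial := by
  have hM0 : 0 ≤ M := (norm_nonneg _).trans (hM 0)
  induction n generalizing t with
  | zero => simp [dyson]
  | succ n ih =>
    have hb : ∀ r, ‖A r * dyson A n r‖ ≤ ‖(1 : 𝔸)‖ * M ^ (n + 1) / n.factorial * |r| ^ n := by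
      intro r
      refine (norm_mul_le _ _).trans ((mul_le_mul (hM r) (ih r) (norm_nonneg _) hM0).trans
        (le_of_eq ?_))
      rw [mul_pow]; ring
    have hi : ∀ t : ℝ, 0 ≤ t → ∫ r in (0 : ℝ)..t, ‖(1 : 𝔸)‖ * M ^ (n + 1) / n.factorial * |r| ^ n =
        ‖(1 : 𝔸)‖ * (M * t) ^ (n + 1) / (n + 1).factorial := by
      intro t ht
      have : ∫ r in (0 : ℝ)..t, ‖(1 : 𝔸)‖ * M ^ (n + 1) / n.factorial * |r| ^ n =
          ∫ r in (0 : ℝ)..t, ‖(1 : 𝔸)‖ * M ^ (n + 1) / n.factorial * r ^ n := by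
        refine intervalIntegral.integral_congr fun r hr => ?_
        rw [Set.uIcc_of_le ht] at hr
        simp only [abs_of_nonneg hr.1]
      rw [this, intervalIntegral.integral_const_mul, integral_pow, Nat.factorial_succ]
      have : (n.factorial : ℝ) ≠ 0 := by positivity
      push_cast
      field_simp
      simp only [mul_pow, zero_pow (Nat.succ_ne_zero n), sub_zero]
      ring
    have hc : Continuous fun r : ℝ => ‖(1 : 𝔸)‖ * M ^ (n + 1) / n.factorial * |r| ^ n := by
      fun_prop
    change ‖∫ r in (0 : ℝ)..t, A r * dyson A n r‖ ≤ _
    rcases le_total 0 t with ht | ht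
    · rw [abs_of_nonneg ht, ← hi t ht]
      exact intervalIntegral.norm_integral_le_of_norm_le ht (Eventually.of_forall fun r _ => hb r)
        (hc.intervalIntegrable _ _)
    · rw [abs_of_nonpos ht, ← hi (-t) (by linarith), intervalIntegral.integral_symm, norm_neg]
      have : ∫ r in (0 : ℝ)..(-t), ‖(1 : 𝔸)‖ * M ^ (n + 1) / n.factorial * |r| ^ n =
          ∫ r in t..0, ‖(1 : 𝔸)‖ * M ^ (n + 1) / n.factorial * |r| ^ n := by
        have := intervalIntegral.integral_comp_neg (a := t) (b := 0)
          (fun r : ℝ => ‖(1 : 𝔸)‖ * M ^ (n + 1) / n.factorial * |r| ^ n)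
        simp only [abs_neg, neg_zero] at this
        exact this.symm
      rw [this]
      exact intervalIntegral.norm_integral_le_of_norm_le ht (Eventually.of_forall fun r _ => hb r)
        (hc.intervalIntegrable _ _)

/-- Solution of the linear differential equation `Z' = A Z`, `Z 0 = 1` on `(-1, 1)`. -/
theorem exists_linear_ode (𝔸 : Type*) [NormedRing 𝔸] [NormedAlgebra ℝ 𝔸] [CompleteSpace 𝔸] (M : ℝ) :
    ∃ K : ℝ, ∀ A : ℝ → 𝔸, Continuous A → (∀ t, ‖A t‖ ≤ M) → ∃ Z : ℝ → 𝔸, Z 0 = 1 ∧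
      (∀ t ∈ Set.Ioo (-1 : ℝ) 1, HasDerivAt Z (A t * Z t) t) ∧
      ∀ t ∈ Set.Ioo (-1 : ℝ) 1, ‖Z t‖ ≤ K := by
  refine ⟨∑' n : ℕ, ‖(1 : 𝔸)‖ * M ^ n / n.factorial, fun A hA hM => ?_⟩
  have hM0 : 0 ≤ M := (norm_nonneg _).trans (hM 0)
  have hsum : Summable fun n : ℕ => ‖(1 : 𝔸)‖ * M ^ n / n.factorial := by
    simp_rw [mul_div_assoc]
    exact (Real.summable_pow_div_factorial M).mul_left _
  have hb : ∀ n, ∀ t ∈ Set.Ioo (-1 : ℝ) 1, ‖dyson A n t‖ ≤ ‖(1 : 𝔸)‖ * M ^ n / n.factorial := by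
    intro n t ht
    refine (norm_dyson_le hM n t).trans ?_
    have : M * |t| ≤ M := mul_le_of_le_one_right hM0 (abs_lt.2 ht).le
    gcongr
  have hs : ∀ t ∈ Set.Ioo (-1 : ℝ) 1, Summable fun n => dyson A n t := fun t ht =>
    Summable.of_norm_bounded hsum fun n => hb n t ht
  refine ⟨fun t => ∑' n, dyson A n t, ?_, fun t ht => ?_, fun t ht =>
    tsum_of_norm_bounded hsum.hasSum fun n => hb n t ht⟩
  · change ∑' n, dyson A n 0 = 1
    rw [tsum_eq_single 0]
    · rfl
    · intro n hn
      obtain ⟨k, rfl⟩ := Nat.exists_eq_succ_of_ne_zero hn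
      simp [dyson]
  · have h0 : (0 : ℝ) ∈ Set.Ioo (-1 : ℝ) 1 := by simp
    have hd := hasDerivAt_tsum_of_isPreconnected (𝕜 := ℝ) (t := Set.Ioo (-1 : ℝ) 1)
      (g := fun n t => dyson A (n + 1) t) (g' := fun n t => A t * dyson A n t)
      (hsum.mul_left M) isOpen_Ioo isPreconnected_Ioo (fun n y _ => hasDerivAt_dyson hA n y)
      (fun n y hy => (norm_mul_le _ _).trans
        (mul_le_mul (hM y) (hb n y hy) (norm_nonneg _) hM0)) h0
      ((summable_nat_add_iff 1).2 (hs 0 h0)) ht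
    rw [(hs t ht).tsum_mul_left] at hd
    refine (hd.const_add (1 : 𝔸)).congr_of_eventuallyEq ?_
    filter_upwards [isOpen_Ioo.mem_nhds ht] with s hs'
    rw [(hs s hs').tsum_eq_zero_add]
    rfl

-- Grönwall's inequality for `W - 1`, which vanishes at `0`.
omit [CompleteSpace 𝔸] in
theorem eq_one_of_hasDerivAt {W W' : ℝ → 𝔸} {K : ℝ} (h0 : W 0 = 1)
    (hd : ∀ t ∈ Set.Ioo (-1 : ℝ) 1, HasDerivAt W (W' t) t)
    (hb : ∀ t ∈ Set.Ioo (-1 : ℝ) 1, ‖W' t‖ ≤ K * ‖W t - 1‖) {t : ℝ} (ht : t ∈ Set.Ico (0 : ℝ) 1) :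
    W t = 1 := by
  have hsub : ∀ s ∈ Set.Icc 0 t, s ∈ Set.Ioo (-1 : ℝ) 1 := fun s hs =>
    ⟨by linarith [hs.1], by linarith [hs.2, ht.2]⟩
  have := eq_zero_of_abs_deriv_le_mul_abs_self_of_eq_zero_right (f := fun t => W t - 1) (f' := W')
    (K := K) (a := 0) (b := t)
    (fun s hs => ((hd s (hsub s hs)).sub_const 1).continuousAt.continuousWithinAt)
    (fun s hs => ((hd s (hsub s ⟨hs.1, hs.2.le⟩)).sub_const 1).hasDerivWithinAt)
    (by simp [h0]) (fun s hs => hb s (hsub s ⟨hs.1, hs.2.le⟩)) t ⟨ht.1, le_rfl⟩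
  exact sub_eq_zero.1 this

/-- The solutions of `Z' = A Z` and `V' = - V A` are inverse to each other. -/
theorem exists_linear_ode_pair (𝔸 : Type*) [NormedRing 𝔸] [NormedAlgebra ℝ 𝔸] [CompleteSpace 𝔸]
    [StarRing 𝔸] [NormedStarGroup 𝔸] [StarModule ℝ 𝔸] (M : ℝ) :
    ∃ K : ℝ, ∀ A : ℝ → 𝔸, Continuous A → (∀ t, ‖A t‖ ≤ M) → ∃ V Z : ℝ → 𝔸, V 0 = 1 ∧ Z 0 = 1 ∧
      (∀ t ∈ Set.Ioo (-1 : ℝ) 1, HasDerivAt V (-(V t * A t)) t) ∧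
      (∀ t ∈ Set.Ioo (-1 : ℝ) 1, ‖V t‖ ≤ K ∧ ‖Z t‖ ≤ K) ∧
      ∀ t ∈ Set.Ico (0 : ℝ) 1, V t * Z t = 1 ∧ Z t * V t = 1 := by
  obtain ⟨K, hK⟩ := exists_linear_ode 𝔸 M
  refine ⟨K, fun A hA hM => ?_⟩
  obtain ⟨Z, hZ0, hZ, hZb⟩ := hK A hA hM
  -- The right-sided equation `V' = -V A` is the adjoint of the left-sided equation `Y' = -A* Y`,
  -- whose coefficient has the same norm bound.
  obtain ⟨Y, hY0, hY, hYb⟩ := hK (fun t => -star (A t)) (continuous_star.comp hA).neg fun t => by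
    rw [norm_neg, norm_star]; exact hM t
  have hV : ∀ t ∈ Set.Ioo (-1 : ℝ) 1, HasDerivAt (fun t => star (Y t)) (-(star (Y t) * A t)) t := by
    intro t ht
    have := (hY t ht).star
    simpa using this
  refine ⟨fun t => star (Y t), Z, by simp [hY0], hZ0, hV, fun t ht => ⟨by
    rw [norm_star]; exact hYb t ht, hZb t ht⟩, fun t ht => ⟨?_, ?_⟩⟩
  · refine eq_one_of_hasDerivAt (W := fun t => star (Y t) * Z t) (K := 0) (by simp [hY0, hZ0])
      (fun t ht => (hV t ht).mul (hZ t ht)) (fun t ht => ?_) ht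
    simp [mul_assoc]
  · refine eq_one_of_hasDerivAt (W := fun t => Z t * star (Y t)) (K := M + M)
      (by simp [hY0, hZ0]) (fun t ht => (hZ t ht).mul (hV t ht)) (fun t ht => ?_) ht
    -- While `V Z` has zero derivative, the derivative of `Z V` is its commutator with `A`.
    -- Subtracting `1` from `Z V` leaves the commutator unchanged, and Grönwall applies with
    -- constant `2M`.
    have h1 : A t * Z t * star (Y t) + Z t * -(star (Y t) * A t) =
        A t * (Z t * star (Y t) - 1) - (Z t * star (Y t) - 1) * A t := by noncomm_ring
    rw [h1, add_mul]
    refine (norm_sub_le _ _).trans (add_le_add ((norm_mul_le _ _).trans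
      (mul_le_mul_of_nonneg_right (hM t) (norm_nonneg _))) ((norm_mul_le _ _).trans ?_))
    rw [mul_comm]
    exact mul_le_mul_of_nonneg_right (hM t) (norm_nonneg _)

end LinearODE

section

variable {H : Type u} [NormedAddCommGroup H] [InnerProductSpace ℂ H] [CompleteSpace H]
  {ι κ : Type*}

/-! ### Compact resolvent and eigenbasis of the perturbed Hamiltonian -/

section Resolvent

/-- Truncation to the finitely many large entries gives a finite-rank operator within `ε / 2` in
norm. -/
theorem isCompactOperator_diag (b : HilbertBasis ι ℂ H) {c : ι → ℂ} {C : ℝ} (hC : ∀ i, ‖c i‖ ≤ C)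
    (h0 : Tendsto c cofinite (𝓝 0)) : IsCompactOperator (diag b c) := by
  classical
  have hcl : diag b c ∈ closure {f : H →L[ℂ] H | IsCompactOperator f} := by
    rw [Metric.mem_closure_iff]
    intro ε hε
    have hfin : {i | ¬ ‖c i‖ < ε / 2}.Finite := by
      have := (tendsto_zero_iff_norm_tendsto_zero.1 h0).eventually_lt_const (half_pos hε)
      exact this
    let F : H →L[ℂ] H := ∑ i ∈ hfin.toFinset, (innerSL ℂ (b i)).smulRight (c i • b i)
    have hF : IsCompactOperator F := by
      have : F ∈ compactOperator (RingHom.id ℂ) H H := by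
        refine Submodule.sum_mem _ fun i _ => ?_
        have h1 : IsCompactOperator (innerSL ℂ (b i)) :=
          isCompactOperator_of_locallyCompactSpace_dom _
        exact h1.clm_comp (ContinuousLinearMap.toSpanSingleton ℂ (c i • b i))
      exact this
    refine ⟨F, hF, ?_⟩
    rw [dist_eq_norm]
    refine lt_of_le_of_lt (ContinuousLinearMap.opNorm_le_bound _ (half_pos hε).le fun x =>
      norm_le_of_coord b (half_pos hε).le fun i => ?_) (half_lt_self hε)
    have hFi : inner ℂ (b i) (F x) =
        if i ∈ hfin.toFinset then c i * inner ℂ (b i) x else 0 := by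
      simp only [F, sum_apply, ContinuousLinearMap.smulRight_apply,
        innerSL_apply_apply, inner_sum, inner_smul_right, orthonormal_iff_ite.1 b.orthonormal]
      simp [mul_comm]
    rw [sub_apply, inner_sub_right, inner_diag b hC, hFi]
    split_ifs with hi
    · simpa using by positivity
    · have hi' : ‖c i‖ < ε / 2 := by simpa using hi
      rw [sub_zero, norm_mul]
      exact mul_le_mul_of_nonneg_right hi'.le (norm_nonneg _)
  exact isClosed_setOfPred_isCompactOperator.closure_subset hcl

omit [CompleteSpace H] in
theorem mem_graph_add_bdd {A : H →ₗ.[ℂ] H} {X : H →L[ℂ] H} {x y : H} :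
    (x, y) ∈ (A + bdd X).graph ↔ (x, y - X x) ∈ A.graph := by
  rw [LinearPMap.mem_graph_iff, LinearPMap.mem_graph_iff]
  constructor
  · rintro ⟨⟨z, hz1, hz2⟩, hz, h⟩
    simp only at hz h
    subst hz
    refine ⟨⟨z, hz1⟩, rfl, ?_⟩
    simp only
    rw [eq_sub_iff_add_eq, ← h]
    rfl
  · rintro ⟨⟨z, hz1⟩, hz, h⟩
    simp only at hz h
    subst hz
    refine ⟨⟨z, hz1, trivial⟩, rfl, ?_⟩
    simp only
    rw [eq_sub_iff_add_eq] at h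
    rw [← h]
    rfl

theorem Weight.IsBasis.mem_hamiltonian {ρ : Weight H} {b : HilbertBasis ι ℂ H} {l : ι → ℝ}
    (h : ρ.IsBasis b l) {x y : H} : (x, y) ∈ (hamiltonian ρ.op).graph ↔
      ∀ i, inner ℂ (b i) y = ((-Real.log (l i) : ℝ) : ℂ) * inner ℂ (b i) x :=
  h.isEigenbasis.mem_spectralFun _

/-- The resolvent of `H₀ + X` at a point below its spectrum. -/
theorem exists_resolvent (ρ : Weight H) {X : H →L[ℂ] H} (hX : IsSelfAdjoint X) :
    ∃ (R : H →L[ℂ] H) (c : ℝ), IsCompactOperator R ∧ IsSelfAdjoint R ∧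
      ∀ x y, (x, y) ∈ (hamiltonian ρ.op + bdd X).graph ↔ R (y + (c : ℂ) • x) = x := by
  obtain ⟨ι, b, l, hpos, heig, p, hp0, hp1, hs⟩ := ρ.exists_basis
  have hb : ρ.IsBasis b l := ⟨hpos, heig⟩
  -- Since `H₀ ≥ -log ‖ρ‖`, this shift makes `H₀ + c ≥ ‖X‖ + 1`, enough for the Neumann series
  -- below.
  set c : ℝ := ‖X‖ + 1 + |Real.log ‖ρ.op‖| with hc
  have hd : ∀ i, ‖X‖ + 1 ≤ -Real.log (l i) + c := by
    intro i
    have := Real.log_le_log (hpos i) (hb.le_norm i)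
    have := le_abs_self (Real.log ‖ρ.op‖)
    linarith
  have hX0 : 0 < ‖X‖ + 1 := by positivity
  let g : ι → ℝ := fun i => (-Real.log (l i) + c)⁻¹
  have hg0 : ∀ i, 0 < g i := fun i => inv_pos.2 (hX0.trans_le (hd i))
  have hg : ∀ i, ‖(g i : ℂ)‖ ≤ (‖X‖ + 1)⁻¹ := fun i => by
    rw [Complex.norm_real, Real.norm_of_nonneg (hg0 i).le]
    exact inv_anti₀ hX0 (hd i)
  let R₀ := diag b fun i => (g i : ℂ)
  have hR₀i : ∀ i x, inner ℂ (b i) (R₀ x) = g i * inner ℂ (b i) x := inner_diag b hg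
  have hR₀b : ∀ i, R₀ (b i) = (g i : ℂ) • b i := diag_basis b hg
  have hR₀n : ‖R₀‖ ≤ (‖X‖ + 1)⁻¹ := norm_diag_le b (inv_nonneg.2 hX0.le) hg
  have hR₀s : IsSelfAdjoint R₀ :=
    (ContinuousLinearMap.isSelfAdjoint_iff_isSymmetric).2 (inner_eq_conj_of_basis b hR₀b)
  have hR₀c : IsCompactOperator R₀ := by
    refine isCompactOperator_diag b hg ?_
    -- Summability of `l i ^ p` forces `l i` to tend to `0`, so the eigenvalues of `H₀` tend to
    -- infinity and those of `R₀` to `0`.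
    have h1 : Tendsto (fun i => l i ^ p) cofinite (𝓝[>] 0) :=
      tendsto_nhdsWithin_iff.2 ⟨hs.tendsto_cofinite_zero,
        Eventually.of_forall fun i => Real.rpow_pos_of_pos (hpos i) p⟩
    have h2 := Real.tendsto_log_nhdsGT_zero.comp h1
    have h3 : Tendsto (fun i => -Real.log (l i) + c) cofinite atTop := by
      refine tendsto_atTop_add_const_right _ _ (tendsto_neg_atBot_atTop.comp ?_)
      have h4 : Tendsto (fun i => p⁻¹ * Real.log (l i ^ p)) cofinite atBot :=
        h2.const_mul_atBot (inv_pos.2 hp0)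
      refine h4.congr fun i => ?_
      rw [Real.log_rpow (hpos i), inv_mul_cancel_left₀ hp0.ne']
    have h4 : Tendsto g cofinite (𝓝 0) := tendsto_inv_atTop_zero.comp h3
    have h5 := (Complex.continuous_ofReal.tendsto 0).comp h4
    simpa only [Complex.ofReal_zero, Function.comp_def] using h5
  have hH₀ : ∀ x y, (x, y) ∈ (hamiltonian ρ.op).graph ↔ R₀ (y + (c : ℂ) • x) = x := by
    intro x y
    rw [hb.mem_hamiltonian]
    have hgi : ∀ i, (g i : ℂ) * ((-Real.log (l i) : ℝ) + (c : ℂ)) = 1 := fun i => by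
      rw [← Complex.ofReal_add, ← Complex.ofReal_mul, inv_mul_cancel₀ (hX0.trans_le (hd i)).ne',
        Complex.ofReal_one]
    constructor
    · intro h
      refine basis_ext b fun i => ?_
      rw [hR₀i, inner_add_right, inner_smul_right, h i, ← add_mul, ← mul_assoc, hgi, one_mul]
    · intro h i
      have h1 := hR₀i i (y + (c : ℂ) • x)
      rw [h, inner_add_right, inner_smul_right] at h1
      have h2 : (g i : ℂ) ≠ 0 := by exact_mod_cast (hg0 i).ne'
      refine mul_left_cancel₀ h2 ?_
      linear_combination -(inner ℂ (b i) x) * hgi i - h1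
  -- Factor `H₀ + X + c = (1 + X R₀)(H₀ + c)` with `R₀ = (H₀ + c)⁻¹`; the resolvent is `R₀ (1 + X
  -- R₀)⁻¹`.
  have hlt : ‖-(X * R₀)‖ < 1 := by
    rw [norm_neg]
    calc ‖X * R₀‖ ≤ ‖X‖ * (‖X‖ + 1)⁻¹ := (norm_mul_le _ _).trans (by gcongr)
      _ < 1 := by rw [← div_eq_mul_inv, div_lt_one hX0]; linarith
  let N : (H →L[ℂ] H)ˣ := Units.oneSub _ hlt
  have hN : (N : H →L[ℂ] H) = 1 + X * R₀ := by simp [N]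
  have hNG : ∀ w, (N : H →L[ℂ] H) ((↑N⁻¹ : H →L[ℂ] H) w) = w := fun w =>
    congrArg (fun f : H →L[ℂ] H => f w) N.mul_inv
  have hGN : ∀ w, (↑N⁻¹ : H →L[ℂ] H) ((N : H →L[ℂ] H) w) = w := fun w =>
    congrArg (fun f : H →L[ℂ] H => f w) N.inv_mul
  have hNa : ∀ v, (N : H →L[ℂ] H) v = v + X (R₀ v) := fun v => by rw [hN]; rfl
  refine ⟨R₀ * ↑N⁻¹, c, hR₀c.comp_clm _, ?_, fun x y => ?_⟩
  · have h1 : star (N : H →L[ℂ] H) * R₀ = R₀ * N := by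
      rw [hN, star_add, star_mul, star_one, hR₀s.star_eq, hX.star_eq]
      noncomm_ring
    have h2 : star (↑N⁻¹ : H →L[ℂ] H) * star (N : H →L[ℂ] H) = 1 := by
      rw [← star_mul, N.mul_inv, star_one]
    change star (R₀ * (↑N⁻¹ : H →L[ℂ] H)) = _
    rw [star_mul, hR₀s.star_eq]
    calc star (↑N⁻¹ : H →L[ℂ] H) * R₀
        = star (↑N⁻¹ : H →L[ℂ] H) * (R₀ * N) * ↑N⁻¹ := by
          rw [mul_assoc, mul_assoc, N.mul_inv, mul_one]
      _ = R₀ * ↑N⁻¹ := by rw [← h1, ← mul_assoc, h2, one_mul]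
  · rw [mem_graph_add_bdd, hH₀]
    change _ ↔ R₀ ((↑N⁻¹ : H →L[ℂ] H) (y + (c : ℂ) • x)) = x
    have e : y - X x + (c : ℂ) • x = y + (c : ℂ) • x - X x := by abel
    rw [e]
    set w := y + (c : ℂ) • x
    constructor
    · intro h
      have h1 : (N : H →L[ℂ] H) (w - X x) = w := by rw [hNa, h]; abel
      have h2 := hGN (w - X x)
      rw [h1] at h2
      rw [h2, h]
    · intro h
      have h1 := hNG w
      rw [hNa, h] at h1
      have h2 : w - X x = (↑N⁻¹ : H →L[ℂ] H) w := by rw [sub_eq_iff_eq_add]; exact h1.symm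
      rw [h2, h]

/-- `H₀ + X` is diagonal in an orthonormal basis. -/
theorem exists_eigenbasis_perturb (ρ : Weight H) {X : H →L[ℂ] H} (hX : IsSelfAdjoint X) :
    ∃ (κ : Type u) (f : HilbertBasis κ ℂ H) (ν : κ → ℝ),
      IsEigenbasis (hamiltonian ρ.op + bdd X) f ν ∧
      ∀ x y, (x, y) ∈ (hamiltonian ρ.op + bdd X).graph ↔
        ∀ j, inner ℂ (f j) y = ν j * inner ℂ (f j) x := by
  obtain ⟨R, c, hRc, hRs, hR⟩ := exists_resolvent ρ hX
  obtain ⟨κ, f, r, hr⟩ := exists_eigenbasis hRc hRs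
  have hr0 : ∀ j, r j ≠ 0 := by
    intro j h0
    have h1 : ((0 : H), f j) ∈ (hamiltonian ρ.op + bdd X).graph := by
      rw [hR, smul_zero, add_zero, hr, h0]; simp
    exact f.orthonormal.ne_zero j (LinearPMap.graph_fst_eq_zero_snd _ h1 rfl)
  have hν : ∀ j, (r j : ℂ) * (((r j)⁻¹ - c : ℝ) + (c : ℂ)) = 1 := fun j => by
    rw [← Complex.ofReal_add, ← Complex.ofReal_mul, sub_add_cancel, mul_inv_cancel₀ (hr0 j),
      Complex.ofReal_one]
  have hsym := inner_eq_conj_of_basis f hr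
  have hE : IsEigenbasis (hamiltonian ρ.op + bdd X) f fun j => (r j)⁻¹ - c := by
    refine ⟨fun j => ?_, fun x y x' y' h h' => ?_⟩
    · rw [hR, ← add_smul, map_smul, hr, smul_smul, mul_comm, hν, one_smul]
    · rw [hR] at h h'
      have h1 := hsym (y + (c : ℂ) • x) (y' + (c : ℂ) • x')
      rw [h, h', inner_add_right, inner_add_left, inner_smul_left, inner_smul_right,
        Complex.conj_ofReal] at h1
      exact add_right_cancel h1
  refine ⟨κ, f, fun j => (r j)⁻¹ - c, hE, fun x y => ⟨fun h j => hE.inner_of_mem h j, fun h => ?_⟩⟩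
  rw [hR]
  refine basis_ext f fun j => ?_
  rw [inner_basis_apply f hr, inner_add_right, inner_smul_right, h j, ← add_mul, ← mul_assoc, hν,
    one_mul]

end Resolvent

/-! ### The semigroup of powers and the perturbed weight -/

section Semigroup

variable (ρ : Weight H)

theorem norm_pow_le_add_one {s : ℝ} (hs : s ∈ Set.Icc (0 : ℝ) 1) : ‖ρ.pow s‖ ≤ ‖ρ.op‖ + 1 := by
  have hs0 : 0 ≤ (s : ℂ).re := hs.1
  refine (ρ.norm_pow_le hs0).trans ?_
  rw [Complex.ofReal_re]
  calc ‖ρ.op‖ ^ s ≤ (‖ρ.op‖ + 1) ^ s :=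
        Real.rpow_le_rpow (norm_nonneg _) (by linarith) hs.1
    _ ≤ (‖ρ.op‖ + 1) ^ (1 : ℝ) :=
        Real.rpow_le_rpow_of_exponent_le (by linarith [norm_nonneg ρ.op]) hs.2
    _ = _ := Real.rpow_one _

/-- The norms of `ρ^s` are bounded on `[0, 1]`. Hence continuity and derivatives of `s ↦ ρ^s x` may
be computed on finite combinations of eigenvectors. -/
theorem tendstoUniformlyOn_pow {α : Type*} {F : Filter α} {u : α → H} {x : H}
    (h : Tendsto u F (𝓝 x)) :
    TendstoUniformlyOn (fun a (s : ℝ) => ρ.pow s (u a)) (fun s => ρ.pow s x) F (Set.Icc 0 1) := by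
  rw [Metric.tendstoUniformlyOn_iff]
  intro ε hε
  have hK : 0 < ‖ρ.op‖ + 1 := by positivity
  filter_upwards [Metric.tendsto_nhds.1 h (ε / (‖ρ.op‖ + 1)) (by positivity)] with a ha s hs
  rw [dist_comm, dist_eq_norm, ← map_sub]
  refine ((ρ.pow s).le_opNorm _).trans_lt ?_
  rw [dist_eq_norm, lt_div_iff₀ hK] at ha
  calc ‖ρ.pow s‖ * ‖u a - x‖ ≤ (‖ρ.op‖ + 1) * ‖u a - x‖ := by
        gcongr; exact norm_pow_le_add_one ρ hs
    _ < ε := by linarith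

variable {ρ}

theorem Weight.IsBasis.hasDerivAt_pow_sum {b : HilbertBasis ι ℂ H} {l : ι → ℝ} (h : ρ.IsBasis b l)
    (a : ι → ℂ) (F : Finset ι) {s : ℝ} (hs : 0 < s) :
    HasDerivAt (fun s : ℝ => ρ.pow s (∑ i ∈ F, a i • b i))
      (-ρ.pow s (∑ i ∈ F, (((-Real.log (l i) : ℝ) : ℂ) * a i) • b i)) s := by
  have hs0 : 0 ≤ (s : ℂ).re := hs.le
  have h1 : HasDerivAt (fun s : ℝ => ∑ i ∈ F, (((l i ^ s : ℝ) : ℂ) * a i) • b i)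
      (∑ i ∈ F, (((Real.log (l i) * l i ^ s : ℝ) : ℂ) * a i) • b i) s := by
    refine HasDerivAt.fun_sum fun i _ => ?_
    have h2 := ((hasDerivAt_id' s).const_rpow (h.pos i)).ofReal_comp
    have h3 := (h2.mul_const (a i)).smul_const (b i)
    exact h3.congr_deriv (by simp)
  have h4 : -ρ.pow s (∑ i ∈ F, (((-Real.log (l i) : ℝ) : ℂ) * a i) • b i) =
      ∑ i ∈ F, (((Real.log (l i) * l i ^ s : ℝ) : ℂ) * a i) • b i := by
    rw [map_sum, ← Finset.sum_neg_distrib]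
    refine Finset.sum_congr rfl fun i _ => ?_
    rw [map_smul, h.pow_basis hs0, smul_smul, ← neg_smul, ← Complex.ofReal_cpow (h.pos i).le]
    congr 1
    push_cast
    ring
  rw [h4]
  refine h1.congr_of_eventuallyEq ?_
  filter_upwards [lt_mem_nhds hs] with t ht
  have ht0 : 0 ≤ (t : ℂ).re := ht.le
  rw [map_sum]
  refine Finset.sum_congr rfl fun i _ => ?_
  rw [map_smul, h.pow_basis ht0, smul_smul, ← Complex.ofReal_cpow (h.pos i).le, mul_comm]

omit [CompleteSpace H] in
theorem hasSum_inner_smul (b : HilbertBasis ι ℂ H) (x : H) :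
    HasSum (fun i => (inner ℂ (b i) x : ℂ) • b i) x := by
  simpa only [b.repr_apply_apply] using b.hasSum_repr x

/-- For `x` in the domain of `H₀` the coordinates of `y = H₀ x` are square summable, so the termwise
derivatives of the partial sums converge uniformly as well. -/
theorem hasDerivAt_pow {x y : H} (hxy : (x, y) ∈ (hamiltonian ρ.op).graph) {s : ℝ}
    (hs : s ∈ Set.Ioo (0 : ℝ) 1) : HasDerivAt (fun s : ℝ => ρ.pow s x) (-ρ.pow s y) s := by
  obtain ⟨ι, b, l, h⟩ := ρ.exists_isBasis
  rw [h.mem_hamiltonian] at hxy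
  refine hasDerivAt_of_tendstoUniformlyOn (l := atTop)
    (f := fun (F : Finset ι) (s : ℝ) => ρ.pow s (∑ i ∈ F, (inner ℂ (b i) x : ℂ) • b i))
    (f' := fun (F : Finset ι) (s : ℝ) => -ρ.pow s (∑ i ∈ F, (inner ℂ (b i) y : ℂ) • b i))
    (g' := fun s => -ρ.pow s y) isOpen_Ioo
    ((tendstoUniformlyOn_pow ρ (hasSum_inner_smul b y)).mono Set.Ioo_subset_Icc_self).fun_neg
    (Eventually.of_forall fun F s hs => ?_)
    (fun s hs => (tendstoUniformlyOn_pow ρ (hasSum_inner_smul b x)).tendsto_at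
      (Set.Ioo_subset_Icc_self hs)) hs
  simp only [hxy]
  exact h.hasDerivAt_pow_sum _ F hs.1

theorem continuousOn_pow (ρ : Weight H) (x : H) :
    ContinuousOn (fun s : ℝ => ρ.pow s x) (Set.Icc 0 1) := by
  obtain ⟨ι, b, l, h⟩ := ρ.exists_isBasis
  refine (tendstoUniformlyOn_pow ρ (hasSum_inner_smul b x)).continuousOn
    (Eventually.frequently (Eventually.of_forall fun F => ?_))
  have h1 : Continuous (fun s : ℝ => ∑ i ∈ F, (((l i ^ s : ℝ) : ℂ) * inner ℂ (b i) x) • b i) := by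
    refine continuous_finsetSum _ fun i _ => ?_
    have h2 : Continuous fun s : ℝ => l i ^ s :=
      Real.continuous_const_rpow (h.pos i).ne'
    exact ((Complex.continuous_ofReal.comp h2).mul continuous_const).smul continuous_const
  refine h1.continuousOn.congr fun s hs => ?_
  have hs0 : 0 ≤ (s : ℂ).re := hs.1
  simp only
  rw [map_sum]
  refine Finset.sum_congr rfl fun i _ => ?_
  rw [map_smul, h.pow_basis hs0, smul_smul, ← Complex.ofReal_cpow (h.pos i).le, mul_comm]

theorem ofReal_mem_disc {s : ℝ} (hs : s ∈ Set.Ico (0 : ℝ) (1 / 2)) : (s : ℂ) ∈ disc := by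
  simp only [disc, Metric.mem_ball, dist_zero_right, Complex.norm_real, Real.norm_of_nonneg hs.1]
  exact hs.2

theorem IsArakiAnalytic.differentiableOn_conj {X : H →L[ℂ] H} (hX : IsArakiAnalytic ρ X) :
    DifferentiableOn ℂ (fun t => conj ρ t X) disc := by
  obtain ⟨Y, hd, -, hY⟩ := hX
  exact hd.congr fun t ht => boundedExtension_eq ρ (hY t ht)

theorem conj_pow_apply {X : H →L[ℂ] H} (hX : IsArakiAnalytic ρ X) {s : ℝ}
    (hs : s ∈ Set.Ico (0 : ℝ) (1 / 2)) (x : H) :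
    conj ρ s X (ρ.pow s x) = ρ.pow s (X x) :=
  (Weight.isBoundedExtension_iff (t := (s : ℂ)) hs.1).1
    (hX.isBoundedExtension (ofReal_mem_disc hs)) x

/-- The eigenvectors `f` of `H₀ + X` satisfy `V_s ρ^s f = e^{- s ν} f`, with `V` the solution of
`V' = - V ρ^s X ρ^{-s}`, `V 0 = 1`. -/
theorem exists_intertwiner {X : H →L[ℂ] H} (hX : IsArakiAnalytic ρ X) :
    ∃ K : ℝ, ∀ s ∈ Set.Ico (0 : ℝ) (1 / 2), ∃ V Z : H →L[ℂ] H, ‖V‖ ≤ K ∧ ‖Z‖ ≤ K ∧ Z * V = 1 ∧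
      ∀ (ν : ℝ) (f : H), (f, (ν : ℂ) • f) ∈ (hamiltonian ρ.op + bdd X).graph →
        V (ρ.pow s f) = (Real.exp (-(ν * s)) : ℂ) • f := by
  -- The constant `K` depends only on the Araki norm and is fixed before the endpoint `S`, which
  -- makes the limit `s → 1/2` possible.
  obtain ⟨K, hK⟩ := exists_linear_ode_pair (H →L[ℂ] H) (arakiNorm ρ X)
  refine ⟨K, fun S hS => ?_⟩
  have hclamp : ∀ r : ℝ, max 0 (min r S) ∈ Set.Ico (0 : ℝ) (1 / 2) := fun r =>
    ⟨le_max_left _ _, max_lt (by norm_num) ((min_le_right _ _).trans_lt hS.2)⟩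
  -- Clamping to `[0, S]` makes the coefficient continuous and bounded on the whole line, as the
  -- differential equation lemma requires.
  let A : ℝ → H →L[ℂ] H := fun r => conj ρ ((max 0 (min r S) : ℝ) : ℂ) X
  have hA : Continuous A := by
    refine hX.differentiableOn_conj.continuousOn.comp_continuous
      (Complex.continuous_ofReal.comp (by fun_prop)) fun r => ofReal_mem_disc (hclamp r)
  have hAeq : ∀ r ∈ Set.Icc 0 S, A r = conj ρ (r : ℂ) X := fun r hr => by
    simp only [A, min_eq_left hr.2, max_eq_right hr.1]
  obtain ⟨V, Z, hV0, hZ0, hV, hb, hinv⟩ := hK A hA fun r =>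
    norm_conj_le_arakiNorm hX (ofReal_mem_disc (hclamp r))
  have hS1 : S ∈ Set.Ioo (-1 : ℝ) 1 := ⟨by linarith [hS.1], by linarith [hS.2]⟩
  refine ⟨V S, Z S, (hb S hS1).1, (hb S hS1).2, (hinv S ⟨hS.1, hS1.2⟩).2, fun ν f hf => ?_⟩
  rw [mem_graph_add_bdd] at hf
  let ψ : ℝ → H := fun s => (Real.exp (ν * s) : ℂ) • V s (ρ.pow s f)
  have hsub : ∀ s ∈ Set.Icc 0 S, s ∈ Set.Ioo (-1 : ℝ) 1 := fun s hs =>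
    ⟨by linarith [hs.1], by linarith [hs.2, hS.2]⟩
  have hcont : ContinuousOn ψ (Set.Icc 0 S) := by
    refine ContinuousOn.smul (Complex.continuous_ofReal.comp
      (Real.continuous_exp.comp (continuous_const_mul ν))).continuousOn ?_
    refine ContinuousOn.clm_apply (fun s hs => (hV s (hsub s hs)).continuousAt.continuousWithinAt) ?_
    exact (continuousOn_pow ρ f).mono fun s hs => ⟨hs.1, (hsub s hs).2.le⟩
  -- With `H₀ f = ν f - X f`, the derivative of `e^{νs} V_s ρ^s f` is `e^{νs} V_s (ν ρ^s f - A_s ρ^s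
  -- f - ρ^s (ν f - X f))`, which vanishes because `A_s ρ^s f = ρ^s X f`.
  have hder : ∀ s ∈ Set.Ioo 0 S, HasDerivAt ψ 0 s := by
    intro s hs
    have hs' : s ∈ Set.Icc 0 S := ⟨hs.1.le, hs.2.le⟩
    have h1 : HasDerivAt (fun s : ℝ => (Real.exp (ν * s) : ℂ)) ((Real.exp (ν * s) * ν : ℝ) : ℂ) s := by
      simpa using ((hasDerivAt_id s).const_mul ν).exp.ofReal_comp
    have h2 : HasDerivAt (fun s => V s (ρ.pow s f))
        ((-(V s * A s)) (ρ.pow s f) + V s (-ρ.pow s ((ν : ℂ) • f - X f))) s := by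
      have h3 : HasDerivAt (fun s => (V s).restrictScalars ℝ)
          ((-(V s * A s)).restrictScalars ℝ) s :=
        (ContinuousLinearMap.restrictScalarsL ℂ H H ℝ ℝ).hasFDerivAt.comp_hasDerivAt s
          (hV s (hsub s hs'))
      exact h3.clm_apply (hasDerivAt_pow hf ⟨hs.1, (hsub s hs').2⟩)
    refine (h1.smul h2).congr_deriv ?_
    have h4 : A s (ρ.pow s f) = ρ.pow s (X f) := by
      rw [hAeq s hs']
      exact conj_pow_apply hX ⟨hs.1.le, hs.2.trans hS.2⟩ f
    rw [neg_apply, mul_apply_eq_comp, h4, map_sub, map_smul, map_neg, map_sub, map_smul,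
      Complex.ofReal_mul]
    module
  have hconst := constant_of_has_deriv_right_zero hcont (fun s hs => ?_) S ⟨hS.1, le_rfl⟩
  · simp only [ψ, mul_zero, Real.exp_zero, Complex.ofReal_one, one_smul, hV0, Complex.ofReal_zero,
      Weight.pow_zero_eq] at hconst
    have h6 : (Real.exp (-(ν * S)) : ℂ) • ((Real.exp (ν * S) : ℂ) • V S (ρ.pow S f)) =
        V S (ρ.pow S f) := by
      rw [smul_smul, ← Complex.ofReal_mul, ← Real.exp_add]
      simp
    rw [← h6, hconst]
    rfl
  · rcases hs.1.eq_or_lt with h0 | h0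
    -- Differentiability of `ρ^s f` is available only for `s > 0`, so the right derivative at `0` is
    -- obtained as a limit of derivatives.
    · subst h0
      have hSpos : 0 < S := hs.2
      refine hasDerivWithinAt_Ici_of_tendsto_deriv (s := Set.Ioo 0 S)
        (fun s hs => (hder s hs).differentiableAt.differentiableWithinAt)
        ((hcont 0 ⟨le_rfl, hS.1⟩).mono Set.Ioo_subset_Icc_self) (Ioo_mem_nhdsGT hSpos) ?_
      refine tendsto_const_nhds.congr' ?_
      filter_upwards [Ioo_mem_nhdsGT hSpos] with s hs
      exact (hder s hs).deriv.symm
    · exact (hder s ⟨h0, hs.2⟩).hasDerivWithinAt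

/-- The perturbed weight `ρ_X = exp (-H₀ - X)` is a weight, it is nearby `ρ`, and its Hamiltonian
is `H₀ + X`. -/
theorem exists_perturb {X : H →L[ℂ] H} (hX : IsArakiAnalytic ρ X) (hs : IsSelfAdjoint X) :
    ∃ σ : Weight H, bdd σ.op = perturb ρ.op X ∧
      hamiltonian σ.op = hamiltonian ρ.op + bdd X ∧ Nearby ρ σ := by
  obtain ⟨κ, f, ν, hE, hT⟩ := exists_eigenbasis_perturb ρ hs
  obtain ⟨K, hK⟩ := exists_intertwiner hX
  obtain ⟨ι, b, l, hpos, heig, p, hp0, hp1, hsum⟩ := ρ.exists_basis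
  have hb : ρ.IsBasis b l := ⟨hpos, heig⟩
  -- Because `p < 1`, the intertwiner exists at `s = p/2`. It gives `e^{-ν p/2} ≤ K ‖ρ^{p/2} f‖`,
  -- and the squares on the right are summable since `ρ^{p/2}` is Hilbert–Schmidt.
  have hsum' : Summable fun j => Real.exp (-ν j) ^ p := by
    have hp : p / 2 ∈ Set.Ico (0 : ℝ) (1 / 2) := ⟨by linarith, by linarith⟩
    have hp' : 0 ≤ ((p / 2 : ℝ) : ℂ).re := hp.1
    obtain ⟨V, Z, hV, -, -, hVf⟩ := hK (p / 2) hp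
    have h1 : Summable fun i => ‖ρ.pow (p / 2 : ℝ) (b i)‖ ^ 2 := by
      refine hsum.congr fun i => ?_
      rw [hb.pow_basis hp', norm_smul, b.orthonormal.1 i, mul_one, hb.norm_cpow, Complex.ofReal_re,
        ← Real.rpow_natCast, ← Real.rpow_mul (hpos i).le]
      norm_num
    have h2 : Summable fun j => ‖ρ.pow (p / 2 : ℝ) (f j)‖ ^ 2 :=
      summable_sq_norm_of_adjoint b f (fun x y => by
        have := ρ.inner_pow_left hp' x y
        rwa [Complex.conj_ofReal] at this) h1
    refine Summable.of_nonneg_of_le (fun j => Real.rpow_nonneg (Real.exp_pos _).le _) (fun j => ?_)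
      (h2.mul_left (K ^ 2))
    have h3 := (V.le_opNorm (ρ.pow (p / 2 : ℝ) (f j))).trans
      (mul_le_mul_of_nonneg_right hV (norm_nonneg _))
    rw [hVf _ _ (hE.mem j), norm_smul, f.orthonormal.1 j, mul_one, Complex.norm_real,
      Real.norm_of_nonneg (Real.exp_pos _).le] at h3
    have h4 := pow_le_pow_left₀ (Real.exp_pos _).le h3 2
    rw [mul_pow, ← Real.exp_nat_mul] at h4
    rw [← Real.exp_mul]
    refine le_trans (le_of_eq ?_) h4
    congr 1
    push_cast
    ring
  obtain ⟨σ, hσ⟩ := Weight.exists_of_diag f (fun j => Real.exp_pos (-ν j)) hp0 hp1 hsum'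
  have hσb : σ.IsBasis f fun j => Real.exp (-ν j) := ⟨fun j => Real.exp_pos _, hσ⟩
  refine ⟨σ, ?_, ?_, ?_⟩
  · exact (hE.spectralFun_eq_bdd (fun x => (Real.exp (-x) : ℂ))
      fun j x => inner_basis_apply f hσ j x).symm
  · refine LinearPMap.eq_of_eq_graph (Submodule.ext ?_)
    rintro ⟨x, y⟩
    rw [hT, hσb.mem_hamiltonian]
    simp only [Real.log_exp, neg_neg]
  · have key : ∀ s ∈ Set.Ico (0 : ℝ) (1 / 2), ∀ x,
        ‖σ.pow s x‖ ≤ K * ‖ρ.pow s x‖ ∧ ‖ρ.pow s x‖ ≤ K * ‖σ.pow s x‖ := by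
      intro s hs x
      have hs0 : 0 ≤ (s : ℂ).re := hs.1
      obtain ⟨V, Z, hV, hZ, hZV, hVf⟩ := hK s hs
      have h1 : V * ρ.pow s = σ.pow s := by
        refine clm_ext_basis f fun j => ?_
        rw [mul_apply_eq_comp, hVf _ _ (hE.mem j), hσb.pow_basis hs0,
          ← Complex.ofReal_cpow (Real.exp_pos _).le, ← Real.exp_mul, neg_mul]
      have h2 : ρ.pow s = Z * σ.pow s := by rw [← h1, ← mul_assoc, hZV, one_mul]
      constructor
      · rw [← h1]
        exact (V.le_opNorm _).trans (mul_le_mul_of_nonneg_right hV (norm_nonneg _))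
      · conv_lhs => rw [h2]
        exact (Z.le_opNorm _).trans (mul_le_mul_of_nonneg_right hZ (norm_nonneg _))
    -- The two-sided estimate is uniform in `s < 1/2`, so strong continuity carries it to `s = 1/2`.
    have hlim : ∀ (τ : Weight H) x, Tendsto (fun s : ℝ => ‖τ.pow s x‖) (𝓝[<] (1 / 2))
        (𝓝 ‖τ.pow (1 / 2 : ℝ) x‖) := by
      intro τ x
      have h1 : ContinuousAt (fun s : ℝ => τ.pow s x) (1 / 2) :=
        (continuousOn_pow τ x).continuousAt (Icc_mem_nhds (by norm_num) (by norm_num))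
      exact (h1.tendsto.mono_left nhdsWithin_le_nhds).norm
    have hev : ∀ᶠ s : ℝ in 𝓝[<] (1 / 2), s ∈ Set.Ico (0 : ℝ) (1 / 2) :=
      Ico_mem_nhdsLT (by norm_num)
    refine nearby_of_norm_pow_half_le (K := K) (fun x => ?_) fun x => ?_
    · exact le_of_tendsto_of_tendsto (hlim σ x) ((hlim ρ x).const_mul K)
        (hev.mono fun s hs => (key s hs x).1)
    · exact le_of_tendsto_of_tendsto (hlim ρ x) ((hlim σ x).const_mul K)
        (hev.mono fun s hs => (key s hs x).2)

end Semigroup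

end

/-! ### Completeness in the Araki norm -/

section

variable {H : Type u} [NormedAddCommGroup H] [InnerProductSpace ℂ H] [CompleteSpace H]

namespace ArakiSpace

variable {ρ : Weight H}

/-- A bounded operator with `ρ^t X ρ^{-t}` bounded and holomorphic, as an element of the space. -/
def mk (X : H →L[ℂ] H) (h : IsArakiAnalytic ρ X) : ArakiSpace ρ := (⟨X, h⟩ : arakiSubmodule ρ)

theorem op_mk (X : H →L[ℂ] H) (h : IsArakiAnalytic ρ X) : (mk X h).op = X := rfl

theorem op_analytic (X : ArakiSpace ρ) : IsArakiAnalytic ρ X.op := X.2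

theorem op_injective : Function.Injective (op : ArakiSpace ρ → H →L[ℂ] H) :=
  fun _ _ h => Subtype.ext h

theorem op_sub (X Y : ArakiSpace ρ) : (X - Y).op = X.op - Y.op := rfl

theorem norm_conj_le (X : ArakiSpace ρ) {t : ℂ} (ht : t ∈ disc) : ‖conj ρ t X.op‖ ≤ ‖X‖ :=
  norm_conj_le_arakiNorm X.op_analytic ht

theorem norm_le {X : ArakiSpace ρ} {C : ℝ} (h : ∀ t ∈ disc, ‖conj ρ t X.op‖ ≤ C) : ‖X‖ ≤ C := by
  have : Nonempty disc := ⟨⟨0, zero_mem_disc⟩⟩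
  exact ciSup_le fun t : disc => h t t.2

theorem norm_op_le (X : ArakiSpace ρ) : ‖X.op‖ ≤ ‖X‖ := by
  simpa only [conj_zero] using X.norm_conj_le zero_mem_disc

theorem conj_sub (X Y : ArakiSpace ρ) {t : ℂ} (ht : t ∈ disc) :
    conj ρ t (X - Y).op = conj ρ t X.op - conj ρ t Y.op := by
  rw [eq_sub_iff_add_eq, ← conj_add ρ (X - Y).op_analytic Y.op_analytic ht, op_sub, sub_add_cancel]

end ArakiSpace

/-- In coordinates the relation is a family of scalar equations, each continuous in both operators.
-/
theorem isBoundedExtension_of_tendsto (ρ : Weight H) {t : ℂ} {X Y : ℕ → H →L[ℂ] H}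
    {X' Y' : H →L[ℂ] H}
    (h : ∀ n, IsBoundedExtension (cpow ρ.op t) (X n) (cpow ρ.op (-t)) (Y n))
    (hX : Tendsto X atTop (𝓝 X')) (hY : Tendsto Y atTop (𝓝 Y')) :
    IsBoundedExtension (cpow ρ.op t) X' (cpow ρ.op (-t)) Y' := by
  obtain ⟨ι, b, l, hb⟩ := ρ.exists_isBasis
  simp only [isBoundedExtension_iff, hb.mem_cpow (t := t)] at h ⊢
  intro x y hxy i
  have h1 : Tendsto (fun n => inner ℂ (b i) (Y n x)) atTop (𝓝 (inner ℂ (b i) (Y' x))) :=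
    tendsto_const_nhds.inner (((ContinuousLinearMap.apply ℂ H x).continuous.tendsto _).comp hY)
  have h2 : Tendsto (fun n => inner ℂ (b i) (X n y)) atTop (𝓝 (inner ℂ (b i) (X' y))) :=
    tendsto_const_nhds.inner (((ContinuousLinearMap.apply ℂ H y).continuous.tendsto _).comp hX)
  exact tendsto_nhds_unique h1 ((h2.const_mul _).congr fun n => (h n x y hxy i).symm)

/-- A Cauchy sequence makes the functions `t ↦ ρ^t X_n ρ^{-t}` uniformly Cauchy on the disc, so
their limit is bounded and holomorphic. Its value at `t = 0` is the limit operator. -/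
instance ArakiSpace.completeSpace (ρ : Weight H) : CompleteSpace (ArakiSpace ρ) := by
  refine Metric.complete_of_cauchySeq_tendsto fun u hu => ?_
  have hcau : ∀ t ∈ disc, CauchySeq fun n => conj ρ t (u n).op := by
    intro t ht
    rw [Metric.cauchySeq_iff] at hu ⊢
    intro ε hε
    obtain ⟨N, hN⟩ := hu ε hε
    refine ⟨N, fun m hm n hn => lt_of_le_of_lt ?_ (hN m hm n hn)⟩
    rw [dist_eq_norm, dist_eq_norm, ← ArakiSpace.conj_sub _ _ ht]
    exact ArakiSpace.norm_conj_le _ ht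
  have hlim : ∀ t, ∃ Y, t ∈ disc → Tendsto (fun n => conj ρ t (u n).op) atTop (𝓝 Y) := by
    intro t
    by_cases ht : t ∈ disc
    · obtain ⟨Y, hY⟩ := cauchySeq_tendsto_of_complete (hcau t ht)
      exact ⟨Y, fun _ => hY⟩
    · exact ⟨0, fun h => absurd h ht⟩
  choose Y hY using hlim
  have hunif : ∀ ε > 0, ∃ N, ∀ n ≥ N, ∀ t ∈ disc, ‖conj ρ t (u n).op - Y t‖ ≤ ε := by
    intro ε hε
    obtain ⟨N, hN⟩ := Metric.cauchySeq_iff.1 hu ε hε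
    refine ⟨N, fun n hn t ht => ?_⟩
    refine le_of_tendsto ((hY t ht).const_sub (conj ρ t (u n).op)).norm ?_
    filter_upwards [eventually_ge_atTop N] with m hm
    have := hN n hn m hm
    rw [dist_eq_norm] at this
    rw [← ArakiSpace.conj_sub _ _ ht]
    exact (ArakiSpace.norm_conj_le _ ht).trans this.le
  have hd : DifferentiableOn ℂ Y disc := by
    have hU : TendstoUniformlyOn (fun n t => conj ρ t (u n).op) Y atTop disc := by
      rw [Metric.tendstoUniformlyOn_iff]
      intro ε hε
      obtain ⟨N, hN⟩ := hunif (ε / 2) (half_pos hε)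
      filter_upwards [eventually_ge_atTop N] with n hn t ht
      rw [dist_comm, dist_eq_norm]
      exact (hN n hn t ht).trans_lt (half_lt_self hε)
    exact hU.tendstoLocallyUniformlyOn.differentiableOn
      (Eventually.of_forall fun n => (u n).op_analytic.differentiableOn_conj) isOpen_disc
  have hX : Tendsto (fun n => (u n).op) atTop (𝓝 (Y 0)) := by
    simpa only [conj_zero] using hY 0 zero_mem_disc
  have hB : ∀ t ∈ disc, IsBoundedExtension (cpow ρ.op t) (Y 0) (cpow ρ.op (-t)) (Y t) :=
    fun t ht => isBoundedExtension_of_tendsto ρ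
      (fun n => (u n).op_analytic.isBoundedExtension ht) hX (hY t ht)
  have hA : IsArakiAnalytic ρ (Y 0) := by
    obtain ⟨N, hN⟩ := hunif 1 one_pos
    refine ⟨Y, hd, ⟨‖u N‖ + 1, fun t ht => ?_⟩, hB⟩
    have h1 := hN N le_rfl t ht
    have h2 := (u N).norm_conj_le ht
    have h3 := norm_sub_norm_le (Y t) (conj ρ t (u N).op)
    rw [norm_sub_rev] at h3
    linarith
  refine ⟨ArakiSpace.mk (Y 0) hA, ?_⟩
  rw [Metric.tendsto_atTop]
  intro ε hε
  obtain ⟨N, hN⟩ := hunif (ε / 2) (half_pos hε)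
  refine ⟨N, fun n hn => lt_of_le_of_lt ?_ (half_lt_self hε)⟩
  rw [dist_eq_norm]
  refine ArakiSpace.norm_le fun t ht => ?_
  rw [ArakiSpace.conj_sub _ _ ht]
  have : conj ρ t (ArakiSpace.mk (Y 0) hA).op = Y t := boundedExtension_eq ρ (hB t ht)
  rw [this]
  exact hN n hn t ht

instance saArakiSpace.completeSpace (ρ : Weight H) : CompleteSpace (saArakiSpace ρ) := by
  let L : ArakiSpace ρ →ₗ[ℂ] (H →L[ℂ] H) :=
    { toFun := ArakiSpace.op, map_add' := fun _ _ => rfl, map_smul' := fun _ _ => rfl }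
  have hL : Continuous (ArakiSpace.op : ArakiSpace ρ → H →L[ℂ] H) :=
    (L.mkContinuous 1 fun X => by rw [one_mul]; exact X.norm_op_le).continuous
  have hcl : IsClosed (saArakiSpace ρ : Set (ArakiSpace ρ)) :=
    isClosed_eq (continuous_star.comp hL) hL
  exact hcl.completeSpace_coe

/-! ### Charts and the manifold structure -/

section Manifold

variable {ρ σ : Weight H}

theorem bdd_op_eq_spectralFun (ρ : Weight H) :
    bdd ρ.op = spectralFun (fun x => (Real.exp (-x) : ℂ)) (hamiltonian ρ.op) := by
  obtain ⟨ι, b, l, h⟩ := ρ.exists_isBasis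
  have hE : IsEigenbasis (hamiltonian ρ.op) b fun i => -Real.log (l i) :=
    h.isEigenbasis.spectralFun fun x => -Real.log x
  refine (hE.spectralFun_eq_bdd _ fun i x => ?_).symm
  rw [inner_basis_apply b h.eig, neg_neg, Real.exp_log (h.pos i)]

theorem hamiltonian_injective (h : hamiltonian ρ.op = hamiltonian σ.op) : ρ = σ :=
  Subtype.ext (bdd_injective ((bdd_op_eq_spectralFun ρ).trans
    (by rw [h]; exact (bdd_op_eq_spectralFun σ).symm)))

omit [CompleteSpace H] in
theorem add_bdd_zero (A : H →ₗ.[ℂ] H) : A + bdd 0 = A := by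
  refine LinearPMap.eq_of_eq_graph (Submodule.ext ?_)
  rintro ⟨x, y⟩
  rw [mem_graph_add_bdd]
  simp

theorem bdd_op_eq_perturb_zero (ρ : Weight H) : bdd ρ.op = perturb ρ.op 0 := by
  rw [perturb, add_bdd_zero, ← bdd_op_eq_spectralFun]

/-- Eigenvectors of `ρ` lie in the domain of `H₀` and have dense span, so they determine the bounded
part. -/
theorem hamiltonian_add_bdd_injective {X Y : H →L[ℂ] H}
    (h : hamiltonian ρ.op + bdd X = hamiltonian ρ.op + bdd Y) : X = Y := by
  obtain ⟨ι, b, l, hb⟩ := ρ.exists_isBasis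
  have hE : IsEigenbasis (hamiltonian ρ.op) b fun i => -Real.log (l i) :=
    hb.isEigenbasis.spectralFun fun x => -Real.log x
  refine clm_ext_basis b fun i => ?_
  set y := ((-Real.log (l i) : ℝ) : ℂ) • b i
  have h1 : (b i, y + X (b i)) ∈ (hamiltonian ρ.op + bdd X).graph := by
    rw [mem_graph_add_bdd, add_sub_cancel_right]
    exact hE.mem i
  rw [h, mem_graph_add_bdd] at h1
  have h2 := LinearPMap.mem_graph_snd_inj _ h1 (hE.mem i) rfl
  simp only [y] at h2
  rwa [add_sub_assoc, add_eq_left, sub_eq_zero] at h2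

/-- The parametrization `X ↦ ρ_X` of the neighbourhood of `ρ`. -/
def point (ρ : Weight H) (X : saArakiSpace ρ) : Weight H :=
  (exists_perturb X.1.op_analytic X.2).choose

theorem bdd_point (X : saArakiSpace ρ) : bdd (point ρ X).op = perturb ρ.op X.1.op :=
  (exists_perturb X.1.op_analytic X.2).choose_spec.1

theorem hamiltonian_point (X : saArakiSpace ρ) :
    hamiltonian (point ρ X).op = hamiltonian ρ.op + bdd X.1.op :=
  (exists_perturb X.1.op_analytic X.2).choose_spec.2.1

theorem nearby_point (X : saArakiSpace ρ) : Nearby ρ (point ρ X) :=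
  (exists_perturb X.1.op_analytic X.2).choose_spec.2.2

theorem hood_eq_range (ρ : Weight H) : hood ρ = Set.range (point ρ) := by
  ext σ
  refine exists_congr fun X => ?_
  rw [← bdd_point, bdd_injective.eq_iff]
  exact ⟨fun h => Subtype.ext h.symm, fun h => by rw [h]⟩

theorem point_zero (ρ : Weight H) : point ρ 0 = ρ :=
  Subtype.ext (bdd_injective ((bdd_point 0).trans (bdd_op_eq_perturb_zero ρ).symm))

theorem mem_hood_self (ρ : Weight H) : ρ ∈ hood ρ := by
  rw [hood_eq_range]
  exact ⟨0, point_zero ρ⟩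

theorem nearby_of_mem_hood (h : σ ∈ hood ρ) : Nearby ρ σ := by
  rw [hood_eq_range] at h
  obtain ⟨X, rfl⟩ := h
  exact nearby_point X

theorem point_injective (ρ : Weight H) : Function.Injective (point ρ) := by
  intro X Y h
  have h1 := congrArg (fun σ : Weight H => hamiltonian σ.op) h
  simp only [hamiltonian_point] at h1
  exact Subtype.ext (ArakiSpace.op_injective (hamiltonian_add_bdd_injective h1))

theorem saArakiSpace.ext {X Y : saArakiSpace ρ} (h : X.1.op = Y.1.op) : X = Y :=
  Subtype.ext (ArakiSpace.op_injective h)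

theorem saArakiSpace.norm_eq (X : saArakiSpace ρ) : ‖X‖ = arakiNorm ρ X.1.op := rfl

theorem saArakiSpace.op_add (X Y : saArakiSpace ρ) : (X + Y).1.op = X.1.op + Y.1.op := rfl

theorem saArakiSpace.op_sub (X Y : saArakiSpace ρ) : (X - Y).1.op = X.1.op - Y.1.op := rfl

theorem saArakiSpace.op_smul (c : ℝ) (X : saArakiSpace ρ) : (c • X).1.op = (c : ℂ) • X.1.op := rfl

theorem IsArakiAnalytic.of_nearby (h : Nearby ρ σ) {X : H →L[ℂ] H} (hX : IsArakiAnalytic σ X) :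
    IsArakiAnalytic ρ X :=
  arakiSubmodule_le_of_nearby h hX

theorem ArakiSpace.op_mem (X : ArakiSpace ρ) : X.op ∈ arakiSubmodule ρ := X.2

theorem saArakiSpace.isSelfAdjoint (X : saArakiSpace ρ) : IsSelfAdjoint X.1.op := X.2

theorem mem_saArakiSpace {X : ArakiSpace ρ} (h : IsSelfAdjoint X.op) : X ∈ saArakiSpace ρ := h

/-- A self-adjoint element of the Araki space of `σ`, as an element of that of a nearby `ρ`. -/
def transfer (h : Nearby ρ σ) (X : saArakiSpace σ) : saArakiSpace ρ :=
  ⟨ArakiSpace.mk X.1.op (X.1.op_analytic.of_nearby h),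
    mem_saArakiSpace (by rw [ArakiSpace.op_mk]; exact saArakiSpace.isSelfAdjoint X)⟩

theorem op_transfer (h : Nearby ρ σ) (X : saArakiSpace σ) : (transfer h X).1.op = X.1.op :=
  ArakiSpace.op_mk _ _

/-- The identity map between the model spaces of nearby weights. -/
theorem exists_saArakiSpace_map (h : Nearby ρ σ) :
    ∃ L : saArakiSpace σ →L[ℝ] saArakiSpace ρ, ∀ X, (L X).1.op = X.1.op := by
  obtain ⟨c, -, hc⟩ := arakiNorm_le_of_nearby h
  have hadd : ∀ X Y, transfer h (X + Y) = transfer h X + transfer h Y := fun X Y =>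
    saArakiSpace.ext (by rw [op_transfer, saArakiSpace.op_add, saArakiSpace.op_add, op_transfer,
      op_transfer])
  have hsmul : ∀ (a : ℝ) X, transfer h (a • X) = a • transfer h X := fun a X =>
    saArakiSpace.ext (by rw [op_transfer, saArakiSpace.op_smul, saArakiSpace.op_smul, op_transfer])
  have hnorm : ∀ X, ‖transfer h X‖ ≤ c * ‖X‖ := fun X => by
    rw [saArakiSpace.norm_eq, saArakiSpace.norm_eq, op_transfer]
    exact hc X.1.op X.1.op_mem
  let L : saArakiSpace σ →ₗ[ℝ] saArakiSpace ρ := ⟨⟨transfer h, hadd⟩, hsmul⟩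
  exact ⟨L.mkContinuous c hnorm, fun X => op_transfer h X⟩

/-- The changes of coordinates are affine. -/
theorem exists_affine_of_point_eq {X₀ : saArakiSpace ρ} {X₁ : saArakiSpace σ}
    (h : point ρ X₀ = point σ X₁) : ∃ (L : saArakiSpace σ →L[ℝ] saArakiSpace ρ)
      (Z : saArakiSpace ρ), ∀ X, point σ X = point ρ (L X + Z) := by
  -- Both centres are nearby the common point of the two charts, so the model spaces can be
  -- identified.
  have hn : Nearby ρ σ := (nearby_point X₀).trans (h ▸ (nearby_point X₁).symm)
  obtain ⟨L, hL⟩ := exists_saArakiSpace_map hn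
  refine ⟨L, X₀ - L X₁, fun X => hamiltonian_injective ?_⟩
  have h1 : hamiltonian ρ.op + bdd X₀.1.op = hamiltonian σ.op + bdd X₁.1.op := by
    rw [← hamiltonian_point, ← hamiltonian_point, h]
  have h2 : (L X + (X₀ - L X₁)).1.op = X.1.op + (X₀.1.op - X₁.1.op) := by
    rw [saArakiSpace.op_add, saArakiSpace.op_sub, hL, hL]
  rw [hamiltonian_point, hamiltonian_point, h2]
  refine LinearPMap.eq_of_eq_graph (Submodule.ext ?_)
  rintro ⟨x, y⟩
  -- The common point gives `H_ρ + X₀ = H_σ + X₁`, that is, `H_σ + X = H_ρ + (X + X₀ - X₁)`, checked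
  -- on graphs so that domains are included.
  have h3 : (x, y - X.1.op x + X₁.1.op x) ∈ (hamiltonian ρ.op + bdd X₀.1.op).graph ↔
      (x, y - X.1.op x + X₁.1.op x) ∈ (hamiltonian σ.op + bdd X₁.1.op).graph := by rw [h1]
  rw [mem_graph_add_bdd, mem_graph_add_bdd, add_sub_cancel_right] at h3
  rw [mem_graph_add_bdd, mem_graph_add_bdd, ← h3]
  have h4 : y - (X.1.op + (X₀.1.op - X₁.1.op)) x = y - X.1.op x + X₁.1.op x - X₀.1.op x := by
    rw [add_apply, sub_apply]; abel
  rw [h4]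

variable (H) in
/-- The finest topology on the set of weights for which all parametrizations `X ↦ ρ_X` are
continuous. -/
@[reducible]
def weightTopology : TopologicalSpace (Weight H) :=
  ⨆ ρ : Weight H, TopologicalSpace.coinduced (point ρ) inferInstance

attribute [local instance] weightTopology

theorem isOpen_weight_iff {U : Set (Weight H)} :
    IsOpen U ↔ ∀ ρ, IsOpen (point ρ ⁻¹' U) := by
  refine isOpen_iSup_iff.trans ?_
  exact forall_congr' fun ρ => isOpen_coinduced

/-- Seen in another chart, the image of an open set is empty if the charts are disjoint, and
otherwise its preimage under a continuous affine map. -/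
theorem isOpenEmbedding_point (ρ : Weight H) : IsOpenEmbedding (point ρ) := by
  refine .of_continuous_injective_isOpenMap
    (continuous_def.2 fun U hU => isOpen_weight_iff.1 hU ρ) (point_injective ρ) fun U hU => ?_
  rw [isOpen_weight_iff]
  intro σ
  by_cases h : ∃ X₀ X₁, point ρ X₀ = point σ X₁
  · obtain ⟨X₀, X₁, h⟩ := h
    obtain ⟨L, Z, hL⟩ := exists_affine_of_point_eq h
    have : point σ ⁻¹' (point ρ '' U) = (fun X => L X + Z) ⁻¹' U := by
      ext X
      rw [Set.mem_preimage, hL, (point_injective ρ).mem_set_image, Set.mem_preimage]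
    rw [this]
    exact hU.preimage (by fun_prop)
  · convert isOpen_empty
    ext X
    refine ⟨?_, fun h => h.elim⟩
    rintro ⟨X₀, -, h'⟩
    exact h ⟨X₀, X, h'⟩

/-- If the charts at the two points meet, each covers the other's centre, because the affine change
of charts is defined on the whole model space; the points are then separated inside one chart.
Otherwise the charts themselves separate them. -/
theorem t2Space_weight : T2Space (Weight H) := by
  refine ⟨fun σ τ hne => ?_⟩
  have ho : ∀ ρ : Weight H, IsOpen (Set.range (point ρ)) := fun ρ =>
    (isOpenEmbedding_point ρ).isOpen_range
  by_cases h : ∃ X₀ X₁, point σ X₀ = point τ X₁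
  · obtain ⟨X₀, X₁, h⟩ := h
    obtain ⟨L, Z, hL⟩ := exists_affine_of_point_eq h
    have h1 := hL 0
    rw [point_zero] at h1
    have h2 : (0 : saArakiSpace σ) ≠ L 0 + Z := by
      intro h3
      rw [← h3, point_zero] at h1
      exact hne h1.symm
    obtain ⟨u, v, hu, hv, hu0, hvZ, huv⟩ := t2_separation h2
    have he := isOpenEmbedding_point σ
    refine ⟨point σ '' u, point σ '' v, he.isOpenMap _ hu, he.isOpenMap _ hv,
      ⟨0, hu0, point_zero σ⟩, ⟨_, hvZ, h1.symm⟩, (Set.disjoint_image_iff (point_injective σ)).2 huv⟩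
  · refine ⟨_, _, ho σ, ho τ, ⟨0, point_zero σ⟩, ⟨0, point_zero τ⟩, ?_⟩
    rw [Set.disjoint_left]
    rintro _ ⟨X₀, rfl⟩ ⟨X₁, h'⟩
    exact h ⟨X₀, X₁, h'.symm⟩

/-- The chart around `ρ`, the inverse of `X ↦ ρ_X`. -/
def weightChart (ρ : Weight H) : OpenPartialHomeomorph (Weight H) (saArakiSpace ρ) :=
  ((isOpenEmbedding_point ρ).toOpenPartialHomeomorph (point ρ)).symm

theorem weightChart_source (ρ : Weight H) : (weightChart ρ).source = Set.range (point ρ) := by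
  simp [weightChart]

theorem weightChart_target (ρ : Weight H) : (weightChart ρ).target = Set.univ := by
  simp [weightChart]

theorem weightChart_symm_apply (X : saArakiSpace ρ) : (weightChart ρ).symm X = point ρ X := by
  simp [weightChart]

theorem weightChart_point (X : saArakiSpace ρ) : weightChart ρ (point ρ X) = X := by
  rw [← weightChart_symm_apply]
  exact (weightChart ρ).right_inv (by rw [weightChart_target]; trivial)

variable (H) in
/-- The atlas of the Banach manifold of weights. -/
def weightAtlas : BanachAtlas (Weight H) fun ρ : Weight H => saArakiSpace ρ where
  complete := fun ρ => inferInstance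
  chart := weightChart
  cover := fun ρ => ⟨ρ, by rw [weightChart_source]; exact ⟨0, point_zero ρ⟩⟩
  compatible := fun ρ σ => by
    rcases Set.eq_empty_or_nonempty ((weightChart ρ).symm.trans (weightChart σ)).source with h | h
    · rw [h]
      exact contDiffOn_empty
    obtain ⟨X₀, -, h₀⟩ := h
    change (weightChart ρ).symm X₀ ∈ (weightChart σ).source at h₀
    rw [weightChart_source, weightChart_symm_apply] at h₀
    obtain ⟨X₁, h₁⟩ := h₀
    obtain ⟨L, Z, hL⟩ := exists_affine_of_point_eq h₁
    refine (L.contDiff.add contDiff_const).contDiffOn.congr (f := fun X => L X + Z) fun X _ => ?_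
    rw [Function.comp_apply, weightChart_symm_apply, hL, weightChart_point]

end Manifold

end

end

end Araki

theorem mainTheorem3 {H : Type*} [NormedAddCommGroup H] [InnerProductSpace ℂ H] [CompleteSpace H]
    [TopologicalSpace.SeparableSpace H] :
    -- completeness in the Araki norm
    (∀ ρ : Araki.Weight H, CompleteSpace (Araki.ArakiSpace ρ)) ∧
    -- the neighbourhood of `ρ` consists of weights nearby `ρ`; overlapping charts are nearby
    (∀ ρ : Araki.Weight H, ρ ∈ Araki.hood ρ ∧ ∀ σ ∈ Araki.hood ρ, Araki.Nearby ρ σ) ∧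
    (∀ ρ₀ ρ₁ : Araki.Weight H,
      (Araki.hood ρ₀ ∩ Araki.hood ρ₁).Nonempty → Araki.Nearby ρ₀ ρ₁) ∧
    -- for nearby `ρ₀`, `ρ₁`: the Connes cocycle, conjugation with it, equivalence of the norms
    (∀ ρ₀ ρ₁ : Araki.Weight H, Araki.Nearby ρ₀ ρ₁ →
      (∀ t ∈ Araki.disc, Araki.IsBoundedExtension (Araki.cpow ρ₀.op t) 1
          (Araki.cpow ρ₁.op (-t)) (Araki.cocycle ρ₀ ρ₁ t)) ∧
      DifferentiableOn ℂ (Araki.cocycle ρ₀ ρ₁) Araki.disc ∧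
      (∃ C : ℝ, ∀ t ∈ Araki.disc, ‖Araki.cocycle ρ₀ ρ₁ t‖ ≤ C) ∧
      (∀ t ∈ Araki.disc, Araki.cocycle ρ₀ ρ₁ t * Araki.cocycle ρ₁ ρ₀ t = 1 ∧
        Araki.cocycle ρ₁ ρ₀ t * Araki.cocycle ρ₀ ρ₁ t = 1) ∧
      Araki.arakiSubmodule ρ₀ = Araki.arakiSubmodule ρ₁ ∧
      (∀ X ∈ Araki.arakiSubmodule ρ₁, ∀ t ∈ Araki.disc,
        Araki.conj ρ₀ t X =
          Araki.cocycle ρ₀ ρ₁ t * Araki.conj ρ₁ t X * Araki.cocycle ρ₁ ρ₀ t) ∧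
      ∃ c : ℝ, 0 < c ∧ ∀ X ∈ Araki.arakiSubmodule ρ₁,
        Araki.arakiNorm ρ₀ X ≤ c * Araki.arakiNorm ρ₁ X ∧
        Araki.arakiNorm ρ₁ X ≤ c * Araki.arakiNorm ρ₀ X) ∧
    -- the Banach manifold
    ∃ (_ : TopologicalSpace (Araki.Weight H))
      (𝒜 : Araki.BanachAtlas (Araki.Weight H) fun ρ => Araki.saArakiSpace ρ),
      T2Space (Araki.Weight H) ∧
      ∀ ρ : Araki.Weight H,
        (𝒜.chart ρ).source = Araki.hood ρ ∧ (𝒜.chart ρ).target = Set.univ ∧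
        𝒜.chart ρ ρ = 0 ∧
        ∀ X : Araki.saArakiSpace ρ,
          Araki.bdd ((𝒜.chart ρ).symm X).op = Araki.perturb ρ.op X.1.op := by
  open Araki in
  refine ⟨fun ρ => inferInstance, fun ρ => ⟨mem_hood_self ρ, fun σ => nearby_of_mem_hood⟩,
    fun ρ₀ ρ₁ ⟨σ, h₀, h₁⟩ => (nearby_of_mem_hood h₀).trans (nearby_of_mem_hood h₁).symm,
    fun ρ₀ ρ₁ h => ⟨fun t ht => cocycle_spec h ht, cocycle_differentiableOn h, cocycle_bounded h,
      fun t ht => ⟨cocycle_mul_cocycle h ht, cocycle_mul_cocycle h.symm ht⟩,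
      arakiSubmodule_eq_of_nearby h, fun X hX t ht => conj_eq_of_nearby h ht hX, ?_⟩,
    weightTopology H, weightAtlas H, t2Space_weight, fun ρ => ⟨?_, weightChart_target ρ, ?_, ?_⟩⟩
  · obtain ⟨c, hc, h1⟩ := arakiNorm_le_of_nearby h
    obtain ⟨d, hd, h2⟩ := arakiNorm_le_of_nearby h.symm
    have hn : ∀ (ρ : Weight H) X, 0 ≤ arakiNorm ρ X := fun ρ X =>
      Real.iSup_nonneg fun _ => norm_nonneg _
    refine ⟨c + d, add_pos hc hd, fun X hX => ⟨(h1 X hX).trans ?_, (h2 X ?_).trans ?_⟩⟩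
    · exact mul_le_mul_of_nonneg_right (by linarith) (hn _ _)
    · rwa [arakiSubmodule_eq_of_nearby h]
    · exact mul_le_mul_of_nonneg_right (by linarith) (hn _ _)
  · rw [hood_eq_range]
    exact weightChart_source ρ
  · let _ := weightTopology H
    have h := weightChart_point (0 : saArakiSpace ρ)
    rwa [point_zero] at h
  · intro X
    let _ := weightTopology H
    have h := weightChart_symm_apply X
    change bdd ((weightChart ρ).symm X).op = _
    rw [h, bdd_point]
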